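/- Conventions. $|S|$ is the Lebesgue measure of $S\subset\mathbb R^2$, $B(x,r)$ is the closed ball, and $S^{\rho}=\bigcup_{x\in S}B(x,\rho)$ is the $\rho$-neighbourhood of $S$. A non-empty compact set $\mathcal J\subset\mathbb R^2$ is called self-similar if $\mathcal J=\bigcup_{i=1}^s T_i(\mathcal J)$ for finitely many maps $T_i(x)=\lambda_i\mathcal O_i x+z_i$ with $0<\lambda_i<1$, $\mathcal O_i$ orthogonal and $z_i\in\mathbb R^2$. It satisfies the Open Set Condition if the $T_i$ can be chosen so that there is a non-empty open set $O\subset\mathbb R^2$ with $\bigcup_i T_i(O)\subset O$ and with the sets $T_i(O)$ pairwise disjoint. Let $\delta>0$, $0<\alpha\le 1$ and $C>0$. A set $\mathcal A\subset\mathbb R^2$ is an $(\alpha,C,\delta)$-set that is unconcentrated on lines if * $\mathcal A$ is a non-empty union of closed $\delta$-balls such that every $x\in\mathbb R^2$ belongs to at most $C$ of these balls; * $C^{-1}\delta^{2-\alpha}\le|\mathcal A|\le C\delta^{2-\alpha}$; * $|\mathcal A\cap B|\le Cr^{\alpha}|\mathcal A|$ for every ball $B$ of radius $r>0$; * $|\mathcal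 A\cap \ell^{1/C}|\le|\mathcal A|/10$ for every line $\ell$. For $0<\kappa\le 1/2$, $\mathcal A$ is a $(\kappa,C,\delta)$-unrectifiable one-set if it is a $(1,C,\delta)$-set that is unconcentrated on lines and $|\mathcal A\cap R|\le C r_1^{\kappa}r_2^{1-\kappa}|\mathcal A|$ for every rectangle $R$ (in any position) of dimensions $0<r_1\le r_2$. A set $\mathcal A$ is equivalent, with comparability constant $K\ge 1$, to an $(\alpha,C,\delta)$-set that is unconcentrated on lines if there are $(\alpha,C_i,\delta_i)$-sets $\mathcal A_i$ ($i=1,2$) that are unconcentrated on lines, with $K^{-1}C\le C_i\le KC$, $K^{-1}\delta\le\delta_i\le K\delta$ and $\mathcal A_1\subset\mathcal A\subset\mathcal A_2$. Equivalence to a $(\kappa,C,\delta)$-unrectifiable one-set is defined in the same way, through $(\kappa,C_i,\delta_i)$-unrectifiable one-sets with the same $\kappa$. Theorem. Let $0<\alpha\le1$, and let $\mathcal J\subset\mathbb R^2$ be a self-similar set that satisfies the Open Set Condition, has Hausdorff dimension $\alpha$, and is not contained in a line. (a) If $\alpha=1$, there are $\kappa\in(0,1/2]$, $C_0>0$ and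 $K\ge1$, depending only on $\mathcal J$, such that for every $0<\delta\le1$ the set $\mathcal J^\delta$ is equivalent, with comparability constant $K$, to a $(\kappa,C_0,\delta)$-unrectifiable one-set. (b) If $\alpha<1$, there are $C_0>0$ and $K\ge1$, depending only on $\mathcal J$, such that for every $0<\delta\le1$ the set $\mathcal J^\delta$ is equivalent, with comparability constant $K$, to an $(\alpha,C_0,\delta)$-set that is unconcentrated on lines. (c) If $\alpha<1$ and $\varphi:\mathbb R^2\to\mathbb R^2$ is a diffeomorphism (a bijection such that $\varphi$ and $\varphi^{-1}$ are of class $C^1$), there are $C_0>0$ and $K\ge1$, depending only on $\mathcal J$ and $\varphi$, such that for every $0<\delta\le1$ the set $\varphi(\mathcal J^\delta)$ is equivalent, with comparability constant $K$, to an $(\alpha,C_0,\delta)$-set that is unconcentrated on lines. -/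

import Mathlib

open MeasureTheory
open scoped Manifold ContDiff

namespace SelfSimilarPlane

/-- The Euclidean plane; `volume` on it is two-dimensional Lebesgue measure. -/
abbrev Plane : Type := EuclideanSpace ℝ (Fin 2)

/-- A contracting similitude `x ↦ ratio • rot x + shift` of the plane. -/
structure Similitude where
  ratio : ℝ
  ratio_pos : 0 < ratio
  ratio_lt_one : ratio < 1
  rot : Plane ≃ₗᵢ[ℝ] Plane
  shift : Plane

/-- The map of a similitude. -/
noncomputable def Similitude.map (T : Similitude) (x : Plane) : Plane :=
  T.ratio • T.rot x + T.shift

/-- The Open Set Condition for a finite family of similitudes. -/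
def OpenSetCondition {s : ℕ} (T : Fin s → Similitude) : Prop :=
  ∃ O : Set Plane, IsOpen O ∧ O.Nonempty ∧
    (⋃ i, (T i).map '' O) ⊆ O ∧
    ∀ i j, i ≠ j → Disjoint ((T i).map '' O) ((T j).map '' O)

/-- `J` is the self-similar set (the non-empty compact invariant set) of some finite family of
similitudes that satisfies the Open Set Condition. -/
def IsSelfSimilarOSC (J : Set Plane) : Prop :=
  IsCompact J ∧ J.Nonempty ∧
    ∃ (s : ℕ) (T : Fin s → Similitude), J = (⋃ i, (T i).map '' J) ∧ OpenSetCondition T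

/-- The (closed) `ρ`-neighbourhood `⋃_{x ∈ S} B(x, ρ)`, where `B(x, ρ)` is the closed ball. -/
def nbhd (S : Set Plane) (ρ : ℝ) : Set Plane :=
  ⋃ x ∈ S, Metric.closedBall x ρ

/-- `ℓ` is a straight line. -/
def IsLine (ℓ : Set Plane) : Prop :=
  ∃ p v : Plane, v ≠ 0 ∧ ℓ = {x | ∃ t : ℝ, x = p + t • v}

/-- `R` is a rectangle (in any position) with side lengths `r₁` and `r₂`. -/
def IsRectangle (r₁ r₂ : ℝ) (R : Set Plane) : Prop :=
  ∃ p u v : Plane, ‖u‖ = 1 ∧ ‖v‖ = 1 ∧ inner ℝ u v = 0 ∧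
    R = {x | ∃ a b : ℝ, 0 ≤ a ∧ a ≤ r₁ ∧ 0 ≤ b ∧ b ≤ r₂ ∧ x = p + a • u + b • v}

/-- `A` is a non-empty union of closed `δ`-balls with at most `C`-fold overlap;
`P` is the set of the centres. -/
def IsBallUnion (C δ : ℝ) (A : Set Plane) : Prop :=
  ∃ P : Set Plane, P.Nonempty ∧ A = (⋃ p ∈ P, Metric.closedBall p δ) ∧
    ∀ x : Plane, {p ∈ P | x ∈ Metric.closedBall p δ}.Finite ∧
      ({p ∈ P | x ∈ Metric.closedBall p δ}.ncard : ℝ) ≤ C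

/-- `A` is an `(α, C, δ)`-set that is unconcentrated on lines. -/
structure IsUnconcentrated (α C δ : ℝ) (A : Set Plane) : Prop where
  alpha_pos : 0 < α
  alpha_le_one : α ≤ 1
  const_pos : 0 < C
  scale_pos : 0 < δ
  ballUnion : IsBallUnion C δ A
  le_volume : ENNReal.ofReal (C⁻¹ * δ ^ (2 - α)) ≤ volume A
  volume_le : volume A ≤ ENNReal.ofReal (C * δ ^ (2 - α))
  ball_bound : ∀ (x : Plane) (r : ℝ), 0 < r →
    volume (A ∩ Metric.closedBall x r) ≤ ENNReal.ofReal (C * r ^ α) * volume A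
  line_bound : ∀ ℓ : Set Plane, IsLine ℓ → volume (A ∩ nbhd ℓ (1 / C)) ≤ volume A / 10

/-- `A` is a `(κ, C, δ)`-unrectifiable one-set. -/
structure IsUnrectifiableOneSet (κ C δ : ℝ) (A : Set Plane) : Prop where
  kappa_pos : 0 < κ
  kappa_le_half : κ ≤ 1 / 2
  unconcentrated : IsUnconcentrated 1 C δ A
  rectangle_bound : ∀ (r₁ r₂ : ℝ) (R : Set Plane), 0 < r₁ → r₁ ≤ r₂ → IsRectangle r₁ r₂ R →
    volume (A ∩ R) ≤ ENNReal.ofReal (C * r₁ ^ κ * r₂ ^ (1 - κ)) * volume A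

/-- `a ∼ b` with comparability constant `K`. -/
def Comparable (K a b : ℝ) : Prop := a ≤ K * b ∧ b ≤ K * a

/-- For a class `P C δ` of sets that depends on a constant and a scale: `A` is equivalent to a set
of the class `P C δ`, all the comparisons `∼` holding with the constant `K`. -/
def IsEquivalentTo (P : ℝ → ℝ → Set Plane → Prop) (K C δ : ℝ) (A : Set Plane) : Prop :=
  ∃ (C₁ C₂ δ₁ δ₂ : ℝ) (A₁ A₂ : Set Plane),
    Comparable K C₁ C ∧ Comparable K C₂ C ∧ Comparable K δ₁ δ ∧ Comparable K δ₂ δ ∧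
    P C₁ δ₁ A₁ ∧ P C₂ δ₂ A₂ ∧ A₁ ⊆ A ∧ A ⊆ A₂

end SelfSimilarPlane

namespace SelfSimilarPlane

open Metric Set Filter Topology

/-! ### Strips, balls and rectangles in the plane -/

/-! Let ν be the self-similar measure on J with weights `ratio ^ D`, where D is the similarity
dimension. Cut J into pieces of size about r. By the Open Set Condition these carry disjoint copies
of O, each containing a ball of radius comparable to r, so boundedly many pieces meet a ball of
radius r. Hence ν is D-regular (`IsDecomposition.exists_isRegularMeasure`), and comparison with
Hausdorff measure gives D = α.

Strips carry little mass. Since J lies in no line, it lies in no strip of some fixed half-width, so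
at a fixed scale at least one piece misses any given narrow strip. Similitudes pull strips back to
strips, so this loss of a fixed fraction of the mass repeats at every scale, and a strip of
half-width η has mass at most a constant times η ^ κ (`IsDecomposition.exists_strip_bound`). Applied
inside pieces of size r, this bounds the mass of a strip within an r-ball by h ^ κ * r ^ (α - κ)
(`IsDecomposition.exists_slab_bound`), which for α = 1 is the rectangle condition.

Areas reduce to masses. The balls of radius comparable to δ around a δ-separated δ-net of J are
counted by ν, because disjoint δ/2-balls around net points have mass at least a constant times δ ^ α
(`IsRegularMeasure.volume_inter_mul_le`). All conditions on these ball unions follow, and the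
neighbourhood of J lies between two of them.

For a diffeomorphism, the image measure is regular because the map is bi-Lipschitz near J. On small
pieces the map is almost affine, so preimages of thin strips are locally inside thin strips
(`IsDecomposition.exists_preimage_strip_le`). This gives smallness without a rate, which suffices
for being unconcentrated on lines. -/

/-- The strip of half-width `h` around the line with normal `n` and offset `t`. -/
def strip (n : Plane) (t h : ℝ) : Set Plane := {x | |inner ℝ n x - t| ≤ h}

theorem isClosed_strip (n : Plane) (t h : ℝ) : IsClosed (strip n t h) :=
  isClosed_le (by fun_prop) continuous_const

theorem strip_mono (n : Plane) (t : ℝ) {h h' : ℝ} (hh : h ≤ h') : strip n t h ⊆ strip n t h' :=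
  fun _ hx => le_trans hx hh

theorem mem_strip_of_dist_le {n : Plane} (hn : ‖n‖ = 1) {t h d : ℝ} {x y : Plane}
    (hx : x ∈ strip n t h) (hd : dist y x ≤ d) : y ∈ strip n t (h + d) := by
  have h1 : |inner ℝ n (y - x)| ≤ d := by
    refine (abs_real_inner_le_norm n (y - x)).trans ?_
    rwa [hn, one_mul, ← dist_eq_norm]
  have h2 : inner ℝ n y - t = (inner ℝ n x - t) + inner ℝ n (y - x) := by
    rw [inner_sub_right]; ring
  change |inner ℝ n y - t| ≤ h + d
  rw [h2]
  exact (abs_add_le _ _).trans (add_le_add hx h1)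

theorem volume_real_closedBall (x : Plane) {r : ℝ} (hr : 0 ≤ r) :
    volume.real (closedBall x r) = r ^ 2 * Real.pi := by
  rw [Measure.real, EuclideanSpace.volume_closedBall_fin_two, ENNReal.toReal_mul,
    ENNReal.toReal_pow, ENNReal.toReal_ofReal hr, ENNReal.toReal_ofReal Real.pi_pos.le]

theorem measure_closedBall_ne_top (x : Plane) (r : ℝ) : volume (closedBall x r) ≠ ⊤ :=
  measure_closedBall_lt_top.ne

theorem exists_orthonormalBasis_zero_eq {n : Plane} (hn : ‖n‖ = 1) :
    ∃ b : OrthonormalBasis (Fin 2) ℝ Plane, b 0 = n := by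
  have hv : Orthonormal ℝ (Set.domRestrict ({0} : Set (Fin 2)) (fun _ : Fin 2 => n)) := by
    rw [orthonormal_iff_ite]
    rintro ⟨i, hi⟩ ⟨j, hj⟩
    rw [mem_singleton_iff] at hi hj
    subst hi; subst hj
    simp [hn]
  obtain ⟨b, hb⟩ := hv.exists_orthonormalBasis_extension_of_card_eq (by simp)
  exact ⟨b, hb 0 rfl⟩

/-- In orthonormal coordinates with first axis n, the set lies in a box with sides 2h and 2r. -/
theorem volume_real_strip_inter_closedBall_le {n : Plane} (hn : ‖n‖ = 1) (t : ℝ) {h : ℝ}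
    (hh : 0 ≤ h) (x : Plane) {r : ℝ} (hr : 0 ≤ r) :
    volume.real (strip n t h ∩ closedBall x r) ≤ 4 * h * r := by
  obtain ⟨b, rfl⟩ := exists_orthonormalBasis_zero_eq hn
  set u : Fin 2 → ℝ := ![t - h, inner ℝ (b 1) x - r]
  set v : Fin 2 → ℝ := ![t + h, inner ℝ (b 1) x + r]
  have huv : u ≤ v := by
    intro i
    fin_cases i <;> simp [u, v] <;> linarith
  have hmp : MeasurePreserving (fun y => WithLp.ofLp (b.repr y)) (volume : Measure Plane) volume :=
    (PiLp.volume_preserving_ofLp (Fin 2)).comp b.measurePreserving_repr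
  have hsub : strip (b 0) t h ∩ closedBall x r ⊆
      (fun y => WithLp.ofLp (b.repr y)) ⁻¹' (Icc u v) := by
    rintro y ⟨hy, hyx⟩
    have h0 : |inner ℝ (b 0) y - t| ≤ h := hy
    have h1 : |inner ℝ (b 1) (y - x)| ≤ r := by
      refine (abs_real_inner_le_norm (b 1) (y - x)).trans ?_
      rwa [b.orthonormal.1 1, one_mul, ← dist_eq_norm]
    rw [inner_sub_right] at h1
    rw [abs_le] at h0 h1
    rw [mem_preimage, mem_Icc, Pi.le_def, Pi.le_def]
    constructor <;> intro i <;> fin_cases i <;> simp [u, v, b.repr_apply_apply] <;> linarith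
  have hfin : volume (Icc u v) ≠ ⊤ := isCompact_Icc.measure_lt_top.ne
  calc volume.real (strip (b 0) t h ∩ closedBall x r)
      ≤ volume.real ((fun y => WithLp.ofLp (b.repr y)) ⁻¹' (Icc u v)) := by
        refine measureReal_mono hsub ?_
        rwa [hmp.measure_preimage measurableSet_Icc.nullMeasurableSet]
    _ = volume.real (Icc u v) := by
        rw [Measure.real, hmp.measure_preimage measurableSet_Icc.nullMeasurableSet]; rfl
    _ = 4 * h * r := by
        rw [Measure.real, Real.volume_Icc_pi_toReal huv]
        simp [u, v, Fin.prod_univ_two]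
        ring

/-- One normal and one offset serve all widths, so lines can be replaced by strips from here on. -/
theorem IsLine.exists_nbhd_subset_strip {ℓ : Set Plane} (hℓ : IsLine ℓ) :
    ∃ (n : Plane) (t : ℝ), ‖n‖ = 1 ∧ ∀ h, nbhd ℓ h ⊆ strip n t h := by
  obtain ⟨p, v, hv, rfl⟩ := hℓ
  have hnv : ‖(!₂[-v 1, v 0] : Plane)‖ = ‖v‖ := by
    simp [EuclideanSpace.norm_eq, Fin.sum_univ_two, add_comm]
  have hv' : ‖v‖ ≠ 0 := norm_ne_zero_iff.2 hv
  set n : Plane := ‖v‖⁻¹ • !₂[-v 1, v 0]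
  have hn : ‖n‖ = 1 := by
    rw [norm_smul, hnv, norm_inv, norm_norm, inv_mul_cancel₀ hv']
  have hnp : inner ℝ n v = 0 := by
    rw [inner_smul_left]
    simp [PiLp.inner_apply, Fin.sum_univ_two]
    right; ring
  refine ⟨n, inner ℝ n p, hn, fun h x hx => ?_⟩
  simp only [nbhd, mem_iUnion] at hx
  obtain ⟨_, ⟨s, rfl⟩, hx⟩ := hx
  have h0 : p + s • v ∈ strip n (inner ℝ n p) 0 := by
    simp [strip, inner_add_right, inner_smul_right, hnp]
  simpa using mem_strip_of_dist_le hn h0 hx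

theorem IsRectangle.exists_subset_strip_inter_closedBall {r₁ r₂ : ℝ} {R : Set Plane}
    (h₂ : r₁ ≤ r₂) (hR : IsRectangle r₁ r₂ R) :
    ∃ (n : Plane) (t : ℝ) (p : Plane), ‖n‖ = 1 ∧
      R ⊆ strip n t r₁ ∩ closedBall p (2 * r₂) := by
  obtain ⟨p, u, v, hu, hv, huv, rfl⟩ := hR
  refine ⟨u, inner ℝ u p, p, hu, ?_⟩
  rintro _ ⟨a, b, ha, ha', hb, hb', rfl⟩
  constructor
  · simp [strip, inner_add_right, inner_smul_right, huv, hu, abs_of_nonneg ha, ha']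
  · rw [mem_closedBall, dist_eq_norm, show p + a • u + b • v - p = a • u + b • v by abel]
    refine (norm_add_le _ _).trans ?_
    rw [norm_smul, norm_smul, hu, hv, Real.norm_of_nonneg ha, Real.norm_of_nonneg hb]
    linarith

/-! ### Packing and separated nets -/

/-- A family of points is counted by the mass of the disjoint balls around them. -/
theorem card_mul_le_measureReal {ι : Type*} (μ : Measure Plane) (F : Finset ι) (p : ι → Plane)
    {ρ m : ℝ} {E : Set Plane} (hE : μ E ≠ ⊤)
    (hsep : ∀ i ∈ F, ∀ j ∈ F, i ≠ j → Disjoint (closedBall (p i) ρ) (closedBall (p j) ρ))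
    (hm : ∀ i ∈ F, m ≤ μ.real (closedBall (p i) ρ))
    (hsub : ∀ i ∈ F, closedBall (p i) ρ ⊆ E) :
    (F.card : ℝ) * m ≤ μ.real E := by
  have hU : (⋃ i ∈ F, closedBall (p i) ρ) ⊆ E := iUnion₂_subset hsub
  calc (F.card : ℝ) * m = ∑ i ∈ F, m := by simp
    _ ≤ ∑ i ∈ F, μ.real (closedBall (p i) ρ) := Finset.sum_le_sum hm
    _ = μ.real (⋃ i ∈ F, closedBall (p i) ρ) :=
        (measureReal_biUnion_finset (fun i hi j hj hij => hsep i hi j hj hij)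
          (fun i _ => measurableSet_closedBall)
          (fun i hi => ne_top_of_le_ne_top hE (measure_mono (hsub i hi)))).symm
    _ ≤ μ.real E := measureReal_mono hU hE

/-- Area comparison with the ball of radius R + ρ around x; the factor π cancels. -/
theorem card_mul_sq_le {ι : Type*} (F : Finset ι) (p : ι → Plane) {ρ R : ℝ} (hρ : 0 ≤ ρ)
    (hR : 0 ≤ R) (x : Plane)
    (hsep : ∀ i ∈ F, ∀ j ∈ F, i ≠ j → Disjoint (closedBall (p i) ρ) (closedBall (p j) ρ))
    (hsub : ∀ i ∈ F, dist (p i) x ≤ R) :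
    (F.card : ℝ) * ρ ^ 2 ≤ (R + ρ) ^ 2 := by
  have h := card_mul_le_measureReal volume F p (m := ρ ^ 2 * Real.pi)
    (measure_closedBall_ne_top x (R + ρ)) hsep
    (fun i _ => (volume_real_closedBall _ hρ).ge)
    (fun i hi => closedBall_subset_closedBall' (by linarith [hsub i hi]))
  rw [volume_real_closedBall _ (by positivity), ← mul_assoc] at h
  exact le_of_mul_le_mul_right h Real.pi_pos

/-- `P` is a `δ`-separated `δ`-net of `J`. -/
structure IsNet (J : Set Plane) (δ : ℝ) (P : Finset Plane) : Prop where
  subset : ∀ p ∈ P, p ∈ J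
  sep : ∀ p ∈ P, ∀ q ∈ P, p ≠ q → δ < dist p q
  cover : ∀ x ∈ J, ∃ p ∈ P, dist x p ≤ δ

theorem disjoint_closedBall_of_lt_dist {p q : Plane} {δ : ℝ} (h : δ < dist p q) :
    Disjoint (closedBall p (δ / 2)) (closedBall q (δ / 2)) :=
  closedBall_disjoint_closedBall (by linarith)

/-- Packing bounds the cardinality of separated subsets, so one of maximal cardinality exists; a
point farther than δ from it could be added. -/
theorem exists_isNet {J : Set Plane} (hJ : Bornology.IsBounded J) {δ : ℝ} (hδ : 0 < δ) :
    ∃ P : Finset Plane, IsNet J δ P := by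
  classical
  obtain ⟨R, hR, hJR⟩ := hJ.subset_closedBall_lt 0 0
  let S : Set ℕ := {k | ∃ P : Finset Plane, (∀ p ∈ P, p ∈ J) ∧
    (∀ p ∈ P, ∀ q ∈ P, p ≠ q → δ < dist p q) ∧ P.card = k}
  have hS : S.Nonempty := ⟨0, ∅, by simp, by simp, rfl⟩
  have hb : BddAbove S := by
    refine ⟨⌈(R + δ / 2) ^ 2 / (δ / 2) ^ 2⌉₊, ?_⟩
    rintro _ ⟨P, h1, h2, rfl⟩
    have := card_mul_sq_le P id (half_pos hδ).le hR.le 0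
      (fun p hp q hq h => disjoint_closedBall_of_lt_dist (h2 p hp q hq h))
      (fun p hp => hJR (h1 p hp))
    rw [← le_div_iff₀ (by positivity)] at this
    exact_mod_cast this.trans (Nat.le_ceil _)
  obtain ⟨P, h1, h2, h3⟩ := Nat.sSup_mem hS hb
  refine ⟨P, h1, h2, fun x hx => ?_⟩
  by_contra! hc
  have hxP : x ∉ P := fun h => by
    have := hc x h
    rw [dist_self] at this
    linarith
  have : (insert x P).card ∈ S := by
    refine ⟨insert x P, ?_, ?_, rfl⟩
    · intro p hp
      rcases Finset.mem_insert.1 hp with rfl | hp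
      exacts [hx, h1 p hp]
    · intro p hp q hq hpq
      rcases Finset.mem_insert.1 hp with hp' | hp' <;>
        rcases Finset.mem_insert.1 hq with hq' | hq'
      · exact absurd (hp'.trans hq'.symm) hpq
      · rw [hp']; exact hc q hq'
      · rw [hq', dist_comm]; exact hc p hp'
      · exact h2 p hp' q hq' hpq
  have := le_csSup hb this
  rw [Finset.card_insert_of_notMem hxP, ← h3] at this
  omega

/-! ### Neighbourhoods of the support of a regular measure -/

/-- `ν` is an `α`-regular probability measure on `J`, with constants `c` and `C`. -/
structure IsRegularMeasure (α c C : ℝ) (J : Set Plane) (ν : Measure Plane) : Prop where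
  prob : IsProbabilityMeasure ν
  compl : ν Jᶜ = 0
  lower_pos : 0 < c
  upper_pos : 0 < C
  upper : ∀ (x : Plane) (r : ℝ), 0 < r → ν.real (closedBall x r) ≤ C * r ^ α
  lower : ∀ x ∈ J, ∀ r : ℝ, 0 < r → r ≤ 1 → c * r ^ α ≤ ν.real (closedBall x r)

/-- The union of the closed `ρ`-balls centred at the points of `P`. -/
def ballUnion (P : Finset Plane) (ρ : ℝ) : Set Plane := ⋃ p ∈ P, closedBall p ρ

theorem volume_ballUnion_ne_top (P : Finset Plane) (ρ : ℝ) : volume (ballUnion P ρ) ≠ ⊤ :=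
  (P.isCompact_biUnion fun p _ => isCompact_closedBall p ρ).measure_lt_top.ne

section

variable {α c C δ ρ K : ℝ} {J : Set Plane} {ν : Measure Plane} {P : Finset Plane}

theorem IsNet.card_filter_le (hP : IsNet J δ P) (hδ : 0 < δ) (hρ : 0 ≤ ρ) (hρK : ρ ≤ K * δ)
    (x : Plane) :
    {p ∈ (P : Set Plane) | x ∈ closedBall p ρ}.Finite ∧
      ({p ∈ (P : Set Plane) | x ∈ closedBall p ρ}.ncard : ℝ) ≤ 4 * (K + 1) ^ 2 := by
  classical
  have heq : {p ∈ (P : Set Plane) | x ∈ closedBall p ρ} =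
      ((P.filter fun p => x ∈ closedBall p ρ : Finset Plane) : Set Plane) := by
    ext; simp
  rw [heq]
  refine ⟨Finset.finite_toSet _, ?_⟩
  rw [ncard_coe_finset]
  have h := card_mul_sq_le (P.filter fun p => x ∈ closedBall p ρ) id (half_pos hδ).le hρ x
    (fun p hp q hq hpq => disjoint_closedBall_of_lt_dist
      (hP.sep p (Finset.mem_filter.1 hp).1 q (Finset.mem_filter.1 hq).1 hpq))
    (fun p hp => by
      have := (Finset.mem_filter.1 hp).2
      rwa [mem_closedBall, dist_comm] at this)
  have h2 : (ρ + δ / 2) ^ 2 ≤ ((K + 1) * δ) ^ 2 := by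
    refine pow_le_pow_left₀ (by positivity) ?_ 2
    linarith
  have h3 := h.trans h2
  rw [mul_pow, div_pow, ← mul_div_assoc, div_le_iff₀ (by norm_num)] at h3
  have h4 : (0 : ℝ) < δ ^ 2 := by positivity
  refine le_of_mul_le_mul_right (h3.trans_eq ?_) h4
  ring

/-- The transfer from area to mass. Net points whose ρ-ball meets S have disjoint δ/2-balls inside
E, each of mass at least c * (δ / 2) ^ α. Their number is therefore controlled by the mass of E, and
each contributes area at most M. -/
theorem IsRegularMeasure.volume_inter_mul_le (hν : IsRegularMeasure α c C J ν)
    (hα₁ : α ≤ 1) (hδ : 0 < δ) (hδ₁ : δ ≤ 1) (hP : IsNet J δ P) (S E : Set Plane) {M : ℝ}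
    (hE : ∀ p ∈ P, (closedBall p ρ ∩ S).Nonempty → closedBall p (δ / 2) ⊆ E)
    (hM : ∀ p ∈ P, volume.real (closedBall p ρ ∩ S) ≤ M) (hM₀ : 0 ≤ M) :
    volume.real (ballUnion P ρ ∩ S) * δ ^ α ≤ 2 / c * ν.real E * M := by
  classical
  have := hν.prob
  have hc := hν.lower_pos
  set F := P.filter fun p => (closedBall p ρ ∩ S).Nonempty
  have hF : ∀ p ∈ F, p ∈ P := fun p hp => (Finset.mem_filter.1 hp).1
  have h1 := card_mul_le_measureReal ν F id (ρ := δ / 2) (m := c * (δ / 2) ^ α)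
    (E := E) (measure_ne_top _ _)
    (fun p hp q hq hpq => disjoint_closedBall_of_lt_dist (hP.sep p (hF p hp) q (hF q hq) hpq))
    (fun p hp => hν.lower p (hP.subset p (hF p hp)) _ (by positivity) (by linarith))
    (fun p hp => hE p (hF p hp) (Finset.mem_filter.1 hp).2)
  have h2 : volume.real (ballUnion P ρ ∩ S) ≤ F.card * M := by
    have hsub : ballUnion P ρ ∩ S ⊆ ⋃ p ∈ F, closedBall p ρ ∩ S := by
      rintro y ⟨hy, hyS⟩
      simp only [ballUnion, mem_iUnion] at hy
      obtain ⟨p, hp, hyp⟩ := hy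
      simp only [mem_iUnion]
      exact ⟨p, Finset.mem_filter.2 ⟨hp, ⟨y, hyp, hyS⟩⟩, hyp, hyS⟩
    have hfin : volume (⋃ p ∈ F, closedBall p ρ ∩ S) ≠ ⊤ := by
      refine ne_top_of_le_ne_top (volume_ballUnion_ne_top P ρ) (measure_mono ?_)
      exact iUnion₂_subset fun p hp => inter_subset_left.trans
        (subset_biUnion_of_mem (u := fun p => closedBall p ρ) (hF p hp))
    calc volume.real (ballUnion P ρ ∩ S) ≤ volume.real (⋃ p ∈ F, closedBall p ρ ∩ S) :=
          measureReal_mono hsub hfin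
      _ ≤ ∑ p ∈ F, volume.real (closedBall p ρ ∩ S) := measureReal_biUnion_finset_le _ _
      _ ≤ ∑ p ∈ F, M := Finset.sum_le_sum fun p hp => hM p (hF p hp)
      _ = F.card * M := by simp
  have h3 : (2 : ℝ) ^ α ≤ 2 := by
    simpa using Real.rpow_le_rpow_of_exponent_le (one_le_two : (1 : ℝ) ≤ 2) hα₁
  rw [Real.div_rpow hδ.le (by norm_num)] at h1
  have h2α : (0 : ℝ) < 2 ^ α := by positivity
  have hδα : (0 : ℝ) < δ ^ α := by positivity
  have h4 : (F.card : ℝ) * δ ^ α ≤ 2 / c * ν.real E := by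
    have h5 : (F.card : ℝ) * δ ^ α = (2 ^ α / c) * (F.card * (c * (δ ^ α / 2 ^ α))) := by
      field_simp
    rw [h5]
    gcongr
  calc volume.real (ballUnion P ρ ∩ S) * δ ^ α ≤ (F.card * M) * δ ^ α := by gcongr
    _ = (F.card * δ ^ α) * M := by ring
    _ ≤ 2 / c * ν.real E * M := by gcongr

/-- The δ-balls around the net cover J and have mass at most C * δ ^ α each, so the net has many
points; the disjoint δ/2-balls around them lie in the union. -/
theorem IsRegularMeasure.sq_le_volume_mul (hν : IsRegularMeasure α c C J ν)
    (hδ : 0 < δ) (hP : IsNet J δ P) (hρ : δ ≤ ρ) :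
    δ ^ 2 ≤ 2 * C * δ ^ α * volume.real (ballUnion P ρ) := by
  have := hν.prob
  have hC := hν.upper_pos
  have h1 : 1 ≤ P.card * (C * δ ^ α) := by
    have hJ : 1 ≤ ν (⋃ p ∈ P, closedBall p δ) := by
      rw [← measure_univ (μ := ν)]
      calc ν univ ≤ ν ((⋃ p ∈ P, closedBall p δ) ∪ Jᶜ) := by
            refine measure_mono fun x _ => ?_
            by_cases hx : x ∈ J
            · obtain ⟨p, hp, hxp⟩ := hP.cover x hx
              exact Or.inl (mem_biUnion hp hxp)
            · exact Or.inr hx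
        _ ≤ ν (⋃ p ∈ P, closedBall p δ) + ν Jᶜ := measure_union_le _ _
        _ = ν (⋃ p ∈ P, closedBall p δ) := by rw [hν.compl, add_zero]
    have hJ' : 1 ≤ ν.real (⋃ p ∈ P, closedBall p δ) := by
      rw [Measure.real, ← ENNReal.toReal_one]
      exact ENNReal.toReal_mono (measure_ne_top _ _) hJ
    calc (1 : ℝ) ≤ ν.real (⋃ p ∈ P, closedBall p δ) := hJ'
      _ ≤ ∑ p ∈ P, ν.real (closedBall p δ) := measureReal_biUnion_finset_le _ _
      _ ≤ ∑ p ∈ P, C * δ ^ α := Finset.sum_le_sum fun p _ => hν.upper p δ hδ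
      _ = P.card * (C * δ ^ α) := by simp
  have h2 := card_mul_le_measureReal volume P id (ρ := δ / 2) (m := (δ / 2) ^ 2 * Real.pi)
    (E := ballUnion P ρ) (volume_ballUnion_ne_top P ρ)
    (fun p hp q hq hpq => disjoint_closedBall_of_lt_dist (hP.sep p hp q hq hpq))
    (fun p _ => (volume_real_closedBall p (half_pos hδ).le).ge)
    (fun p hp => (closedBall_subset_closedBall (by linarith)).trans
      (subset_biUnion_of_mem (u := fun p => closedBall p ρ) hp))
  have hδα : 0 < δ ^ α := by positivity
  have h3 : (δ / 2) ^ 2 * 2 ≤ (δ / 2) ^ 2 * Real.pi := by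
    gcongr; exact Real.two_le_pi
  calc δ ^ 2 ≤ (P.card * (C * δ ^ α)) * δ ^ 2 := by nlinarith [sq_nonneg δ]
    _ = 2 * (C * δ ^ α) * (P.card * ((δ / 2) ^ 2 * 2)) := by ring
    _ ≤ 2 * (C * δ ^ α) * (P.card * ((δ / 2) ^ 2 * Real.pi)) := by gcongr
    _ ≤ 2 * (C * δ ^ α) * volume.real (ballUnion P ρ) := by gcongr
    _ = _ := by ring

theorem volume_real_closedBall_inter_le (p : Plane) (S : Set Plane) (hδ : 0 < δ) (hρ : δ ≤ ρ)
    (hρK : ρ ≤ K * δ) : volume.real (closedBall p ρ ∩ S) ≤ 4 * K ^ 2 * δ ^ 2 := by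
  have hρ₀ : 0 ≤ ρ := hδ.le.trans hρ
  calc volume.real (closedBall p ρ ∩ S) ≤ volume.real (closedBall p ρ) :=
        measureReal_mono inter_subset_left (measure_closedBall_ne_top p ρ)
    _ = ρ ^ 2 * Real.pi := volume_real_closedBall p hρ₀
    _ ≤ (K * δ) ^ 2 * 4 := by
        gcongr; exact Real.pi_le_four
    _ = _ := by ring

theorem IsRegularMeasure.volume_mul_le (hν : IsRegularMeasure α c C J ν)
    (hα₁ : α ≤ 1) (hδ : 0 < δ) (hδ₁ : δ ≤ 1) (hP : IsNet J δ P) (hρ : δ ≤ ρ) (hρK : ρ ≤ K * δ) :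
    volume.real (ballUnion P ρ) * δ ^ α ≤ 8 * K ^ 2 / c * δ ^ 2 := by
  have := hν.prob
  have h := hν.volume_inter_mul_le hα₁ hδ hδ₁ hP univ univ (ρ := ρ) (M := 4 * K ^ 2 * δ ^ 2)
    (fun _ _ _ => subset_univ _)
    (fun p _ => volume_real_closedBall_inter_le p univ hδ hρ hρK) (by positivity)
  rw [inter_univ, probReal_univ] at h
  refine h.trans_eq ?_
  ring

/-- For r ≥ δ the transfer applies with a concentric ball of comparable radius. For r < δ the
trivial area bound is enough, since 2 - α > 0. -/
theorem IsRegularMeasure.volume_inter_closedBall_le (hν : IsRegularMeasure α c C J ν)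
    (hα₁ : α ≤ 1) (hK : 1 ≤ K) (hδ : 0 < δ) (hδ₁ : δ ≤ 1) (hP : IsNet J δ P)
    (hρ : δ ≤ ρ) (hρK : ρ ≤ K * δ) (x : Plane) {r : ℝ} (hr : 0 < r) :
    volume.real (ballUnion P ρ ∩ closedBall x r) ≤
      (16 * K ^ 2 * (K + 2) * C ^ 2 / c + 8 * C) * r ^ α * volume.real (ballUnion P ρ) := by
  have := hν.prob
  have hC := hν.upper_pos
  have hc := hν.lower_pos
  have hδα : 0 < δ ^ α := by positivity
  have hrα : 0 < r ^ α := by positivity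
  have hV := hν.sq_le_volume_mul hδ hP hρ
  have hV₀ : 0 ≤ volume.real (ballUnion P ρ) := measureReal_nonneg
  refine le_of_mul_le_mul_right ?_ hδα
  rcases le_or_gt δ r with h | h
  · have h1 := hν.volume_inter_mul_le hα₁ hδ hδ₁ hP (closedBall x r)
      (closedBall x ((K + 2) * r)) (ρ := ρ) (M := 4 * K ^ 2 * δ ^ 2)
      (fun p _ hne => by
        obtain ⟨y, hy, hyx⟩ := hne
        rw [mem_closedBall] at hy hyx
        refine closedBall_subset_closedBall' ?_
        have h2 := dist_triangle_left p x y
        have h3 : K * δ ≤ K * r := by gcongr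
        linarith)
      (fun p _ => volume_real_closedBall_inter_le p _ hδ hρ hρK) (by positivity)
    have h2 : ν.real (closedBall x ((K + 2) * r)) ≤ C * ((K + 2) * r ^ α) := by
      refine (hν.upper _ _ (by positivity)).trans ?_
      rw [Real.mul_rpow (by positivity) hr.le]
      gcongr
      simpa using Real.rpow_le_rpow_of_exponent_le (by linarith : 1 ≤ K + 2) hα₁
    calc volume.real (ballUnion P ρ ∩ closedBall x r) * δ ^ α
        ≤ 2 / c * (C * ((K + 2) * r ^ α)) * (4 * K ^ 2 * δ ^ 2) :=
          h1.trans (by gcongr)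
      _ ≤ 2 / c * (C * ((K + 2) * r ^ α)) *
          (4 * K ^ 2 * (2 * C * δ ^ α * volume.real (ballUnion P ρ))) := by gcongr
      _ = (16 * K ^ 2 * (K + 2) * C ^ 2 / c + 0) * r ^ α * volume.real (ballUnion P ρ) * δ ^ α := by
          ring
      _ ≤ _ := by gcongr; positivity
  · have h1 : volume.real (ballUnion P ρ ∩ closedBall x r) ≤ 4 * r ^ 2 := by
      calc volume.real (ballUnion P ρ ∩ closedBall x r) ≤ volume.real (closedBall x r) :=
            measureReal_mono inter_subset_right (measure_closedBall_ne_top x r)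
        _ = r ^ 2 * Real.pi := volume_real_closedBall x hr.le
        _ ≤ r ^ 2 * 4 := by gcongr; exact Real.pi_le_four
        _ = _ := by ring
    have h2 : r ^ 2 * δ ^ α ≤ r ^ α * δ ^ 2 := by
      have e : ∀ s : ℝ, 0 < s → s ^ 2 = s ^ α * s ^ (2 - α) := fun s hs => by
        rw [← Real.rpow_add hs, ← Real.rpow_natCast]; norm_num
      rw [e r hr, e δ hδ]
      have : r ^ (2 - α) ≤ δ ^ (2 - α) := Real.rpow_le_rpow hr.le h.le (by linarith)
      calc r ^ α * r ^ (2 - α) * δ ^ α = r ^ α * δ ^ α * r ^ (2 - α) := by ring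
        _ ≤ r ^ α * δ ^ α * δ ^ (2 - α) := by gcongr
        _ = _ := by ring
    calc volume.real (ballUnion P ρ ∩ closedBall x r) * δ ^ α ≤ 4 * r ^ 2 * δ ^ α := by gcongr
      _ = 4 * (r ^ 2 * δ ^ α) := by ring
      _ ≤ 4 * (r ^ α * (2 * C * δ ^ α * volume.real (ballUnion P ρ))) := by
          gcongr 4 * ?_
          exact h2.trans (by gcongr)
      _ = (0 + 8 * C) * r ^ α * volume.real (ballUnion P ρ) * δ ^ α := by ring
      _ ≤ _ := by gcongr; positivity

theorem IsRegularMeasure.volume_inter_strip_mul_le (hν : IsRegularMeasure α c C J ν)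
    (hα₁ : α ≤ 1) (hδ : 0 < δ) (hδ₁ : δ ≤ 1) (hP : IsNet J δ P)
    (hρ : δ ≤ ρ) (hρK : ρ ≤ K * δ) {n : Plane} (hn : ‖n‖ = 1) (t : ℝ) {h : ℝ} :
    volume.real (ballUnion P ρ ∩ strip n t h) ≤
      16 * K ^ 2 * C / c * ν.real (strip n t (h + (K + 1) * δ)) *
        volume.real (ballUnion P ρ) := by
  have := hν.prob
  have hC := hν.upper_pos
  have hc := hν.lower_pos
  have hδα : 0 < δ ^ α := by positivity
  have hV := hν.sq_le_volume_mul hδ hP hρ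
  refine le_of_mul_le_mul_right ?_ hδα
  have h1 := hν.volume_inter_mul_le hα₁ hδ hδ₁ hP (strip n t h)
    (strip n t (h + (K + 1) * δ)) (ρ := ρ) (M := 4 * K ^ 2 * δ ^ 2)
    (fun p _ hne z hz => by
      obtain ⟨y, hy, hys⟩ := hne
      rw [mem_closedBall] at hy hz
      refine mem_strip_of_dist_le hn hys ?_
      have h2 := dist_triangle_right z y p
      linarith)
    (fun p _ => volume_real_closedBall_inter_le p _ hδ hρ hρK) (by positivity)
  calc volume.real (ballUnion P ρ ∩ strip n t h) * δ ^ α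
      ≤ 2 / c * ν.real (strip n t (h + (K + 1) * δ)) * (4 * K ^ 2 * δ ^ 2) := h1
    _ ≤ 2 / c * ν.real (strip n t (h + (K + 1) * δ)) *
          (4 * K ^ 2 * (2 * C * δ ^ α * volume.real (ballUnion P ρ))) := by gcongr
    _ = _ := by ring

end

/-! ### Line and rectangle conditions for unions of balls -/

section

variable {α c C δ ρ K R κ D : ℝ} {J : Set Plane} {ν : Measure Plane} {P : Finset Plane}

theorem ballUnion_subset_closedBall (hJ : J ⊆ closedBall 0 R) (hP : IsNet J δ P)
    (hρ : ρ ≤ K) : ballUnion P ρ ⊆ closedBall 0 (R + K) := by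
  refine iUnion₂_subset fun p hp => closedBall_subset_closedBall' ?_
  have := hJ (hP.subset p hp)
  rw [mem_closedBall] at this
  linarith

/-- Below a threshold δ₀ the fattened strip is still thin and the transfer applies. Above it the
area of the union is bounded below, while a thin strip in a fixed ball has small area. -/
theorem IsRegularMeasure.exists_line_bound (hν : IsRegularMeasure α c C J ν) (hα₀ : 0 < α)
    (hα₁ : α ≤ 1) (hK : 1 ≤ K) (hR : 0 ≤ R) (hJ : J ⊆ closedBall 0 R)
    (hstrip : ∀ ε : ℝ, 0 < ε → ∃ η : ℝ, 0 < η ∧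
      ∀ (n : Plane) (t : ℝ), ‖n‖ = 1 → ν.real (strip n t η) ≤ ε) :
    ∃ h₀ : ℝ, 0 < h₀ ∧ ∀ h ≤ h₀, ∀ δ : ℝ, 0 < δ → δ ≤ 1 → ∀ P : Finset Plane, IsNet J δ P →
      ∀ ρ : ℝ, δ ≤ ρ → ρ ≤ K * δ → ∀ ℓ : Set Plane, IsLine ℓ →
        volume.real (ballUnion P ρ ∩ nbhd ℓ h) ≤ volume.real (ballUnion P ρ) / 10 := by
  have := hν.prob
  have hC := hν.upper_pos
  have hc := hν.lower_pos
  set B : ℝ := 16 * K ^ 2 * C / c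
  have hB : 0 < B := by positivity
  obtain ⟨η, hη, hηs⟩ := hstrip (1 / (10 * B)) (by positivity)
  -- Half of η is reserved for the fattening by (K + 1) * δ, the other half for h.
  set δ₀ : ℝ := η / (2 * (K + 1))
  have hδ₀ : 0 < δ₀ := by positivity
  -- The strip of half-width h₁ has area at most δ₀ ^ 2 / (20 * C) in the ball of radius R + K, a
  -- tenth of the lower bound for the area of the union when δ > δ₀.
  set h₁ : ℝ := δ₀ ^ 2 / (80 * C * (R + K))
  have hh₁ : 0 < h₁ := by positivity
  refine ⟨min (η / 2) h₁, by positivity, ?_⟩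
  intro h hh δ hδ hδ₁ P hP ρ hρ hρK ℓ hℓ
  obtain ⟨n, t, hn, hsub⟩ := hℓ.exists_nbhd_subset_strip
  set V := volume.real (ballUnion P ρ)
  have hV₀ : 0 ≤ V := measureReal_nonneg
  rcases le_or_gt δ δ₀ with hs | hs
  · have h1 : volume.real (ballUnion P ρ ∩ nbhd ℓ h) ≤
        volume.real (ballUnion P ρ ∩ strip n t h) :=
      measureReal_mono (inter_subset_inter_right _ (hsub h))
        (ne_top_of_le_ne_top (volume_ballUnion_ne_top P ρ) (measure_mono inter_subset_left))
    have h2 : ν.real (strip n t (h + (K + 1) * δ)) ≤ 1 / (10 * B) := by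
      refine le_trans (measureReal_mono (strip_mono n t ?_)) (hηs n t hn)
      have h3 : (K + 1) * δ ≤ (K + 1) * δ₀ := by gcongr
      have h4 : (K + 1) * δ₀ = η / 2 := by
        simp only [δ₀]; field_simp
      have h5 := hh.trans (min_le_left _ _)
      linarith
    calc volume.real (ballUnion P ρ ∩ nbhd ℓ h)
        ≤ B * ν.real (strip n t (h + (K + 1) * δ)) * V :=
          h1.trans (hν.volume_inter_strip_mul_le hα₁ hδ hδ₁ hP hρ hρK hn t)
      _ ≤ B * (1 / (10 * B)) * V := by gcongr
      _ = V / 10 := by field_simp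
  · have hA : ballUnion P ρ ⊆ closedBall 0 (R + K) :=
      ballUnion_subset_closedBall hJ hP (hρK.trans (by nlinarith))
    have h1 : volume.real (ballUnion P ρ ∩ nbhd ℓ h) ≤
        volume.real (strip n t h₁ ∩ closedBall 0 (R + K)) := by
      refine measureReal_mono ?_
        (ne_top_of_le_ne_top (measure_closedBall_ne_top 0 (R + K)) (measure_mono inter_subset_right))
      rintro x ⟨hx, hx'⟩
      exact ⟨strip_mono n t (hh.trans (min_le_right _ _)) (hsub h hx'), hA hx⟩
    have h2 := volume_real_strip_inter_closedBall_le hn t hh₁.le 0 (by positivity : 0 ≤ R + K)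
    have h3 : 4 * h₁ * (R + K) = δ₀ ^ 2 / (20 * C) := by
      simp only [h₁]; field_simp; norm_num
    have h4 : δ ^ 2 ≤ 2 * C * 1 * V := by
      refine (hν.sq_le_volume_mul hδ hP hρ).trans ?_
      gcongr
      exact Real.rpow_le_one hδ.le hδ₁ hα₀.le
    have h5 : δ₀ ^ 2 ≤ δ ^ 2 := by gcongr
    have h6 : δ₀ ^ 2 / (20 * C) ≤ V / 10 := by
      rw [div_le_div_iff₀ (by positivity) (by norm_num)]
      linarith
    linarith

theorem measure_le_ofReal_mul {S T : Set Plane} {a : ℝ} (ha : 0 ≤ a) (hT : volume T ≠ ⊤)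
    (hST : volume S ≤ volume T) (h : volume.real S ≤ a * volume.real T) :
    volume S ≤ ENNReal.ofReal a * volume T := by
  have hS : volume S ≠ ⊤ := ne_top_of_le_ne_top hT hST
  rw [← ENNReal.ofReal_toReal hS, ← ENNReal.ofReal_toReal hT, ← ENNReal.ofReal_mul ha]
  exact ENNReal.ofReal_le_ofReal h

/-- The union of the `ρ`-balls around a net of the support of a regular measure that does not
charge thin strips is unconcentrated on lines. -/
theorem IsRegularMeasure.exists_isUnconcentrated (hν : IsRegularMeasure α c C J ν) (hα₀ : 0 < α)
    (hα₁ : α ≤ 1) (hK : 1 ≤ K) (hR : 0 ≤ R) (hJ : J ⊆ closedBall 0 R) (hne : J.Nonempty)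
    (hstrip : ∀ ε : ℝ, 0 < ε → ∃ η : ℝ, 0 < η ∧
      ∀ (n : Plane) (t : ℝ), ‖n‖ = 1 → ν.real (strip n t η) ≤ ε) :
    ∃ C₀ : ℝ, 0 < C₀ ∧ ∀ C' ≥ C₀, ∀ δ : ℝ, 0 < δ → δ ≤ 1 → ∀ P : Finset Plane, IsNet J δ P →
      ∀ ρ : ℝ, δ ≤ ρ → ρ ≤ K * δ → IsUnconcentrated α C' ρ (ballUnion P ρ) := by
  have hC := hν.upper_pos
  have hc := hν.lower_pos
  obtain ⟨h₀, hh₀, hline⟩ := hν.exists_line_bound hα₀ hα₁ hK hR hJ hstrip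
  set B₁ : ℝ := 16 * K ^ 2 * (K + 2) * C ^ 2 / c + 8 * C with hB₁
  have hB₁₀ : 0 < B₁ := by positivity
  have hB₂₀ : 0 < 2 * C * K ^ 2 := by positivity
  have hB₃₀ : 0 < 8 * K ^ 2 / c := by positivity
  have hB₄₀ : 0 < 4 * (K + 1) ^ 2 := by positivity
  have hB₅₀ : 0 < 1 / h₀ := by positivity
  -- One summand per condition: ball bound, lower and upper volume bounds, overlap, and 1 / C' ≤ h₀
  -- for lines.
  refine ⟨B₁ + 2 * C * K ^ 2 + 8 * K ^ 2 / c + 4 * (K + 1) ^ 2 + 1 / h₀, by positivity, ?_⟩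
  intro C' hC' δ hδ hδ₁ P hP ρ hρ hρK
  have hC'₀ : 0 < C' := by linarith
  have hρ₀ : 0 < ρ := hδ.trans_le hρ
  have hfin := volume_ballUnion_ne_top P ρ
  set V := volume.real (ballUnion P ρ) with hVdef
  have hV₀ : 0 ≤ V := measureReal_nonneg
  have hδα : 0 < δ ^ α := by positivity
  have hsq : δ ^ 2 = δ ^ α * δ ^ (2 - α) := by
    rw [← Real.rpow_add hδ, ← Real.rpow_natCast]; norm_num
  have hlo : δ ^ (2 - α) ≤ 2 * C * V := by
    refine le_of_mul_le_mul_left ?_ hδα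
    rw [← hsq]
    exact (hν.sq_le_volume_mul hδ hP hρ).trans_eq (by ring)
  have hhi : V ≤ 8 * K ^ 2 / c * δ ^ (2 - α) := by
    refine le_of_mul_le_mul_right ?_ hδα
    refine (hν.volume_mul_le hα₁ hδ hδ₁ hP hρ hρK).trans_eq ?_
    rw [hsq]; ring
  refine
    { alpha_pos := hα₀
      alpha_le_one := hα₁
      const_pos := hC'₀
      scale_pos := hρ₀
      ballUnion := ?_
      le_volume := ?_
      volume_le := ?_
      ball_bound := ?_
      line_bound := ?_ }
  · obtain ⟨x, hx⟩ := hne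
    obtain ⟨p, hp, -⟩ := hP.cover x hx
    refine ⟨P, ⟨p, hp⟩, rfl, fun y => ?_⟩
    obtain ⟨h1, h2⟩ := hP.card_filter_le hδ hρ₀.le hρK y
    exact ⟨h1, h2.trans (by linarith)⟩
  · refine ENNReal.ofReal_le_of_le_toReal ?_
    change C'⁻¹ * ρ ^ (2 - α) ≤ V
    rw [inv_mul_le_iff₀ hC'₀]
    calc ρ ^ (2 - α) ≤ (K * δ) ^ (2 - α) := Real.rpow_le_rpow hρ₀.le hρK (by linarith)
      _ = K ^ (2 - α) * δ ^ (2 - α) := Real.mul_rpow (by positivity) hδ.le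
      _ ≤ K ^ 2 * (2 * C * V) := by
          gcongr
          calc K ^ (2 - α) ≤ K ^ (2 : ℝ) := Real.rpow_le_rpow_of_exponent_le hK (by linarith)
            _ = K ^ 2 := by norm_cast
      _ = (2 * C * K ^ 2) * V := by ring
      _ ≤ C' * V := by gcongr; linarith
  · rw [ENNReal.le_ofReal_iff_toReal_le hfin (by positivity)]
    change V ≤ _
    calc V ≤ 8 * K ^ 2 / c * δ ^ (2 - α) := hhi
      _ ≤ C' * ρ ^ (2 - α) := by
          gcongr
          · linarith
          · linarith
  · intro x r hr
    refine measure_le_ofReal_mul (by positivity) hfin (measure_mono inter_subset_left) ?_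
    refine (hν.volume_inter_closedBall_le hα₁ hK hδ hδ₁ hP hρ hρK x hr).trans ?_
    gcongr
    rw [← hB₁]
    linarith
  · intro ℓ hℓ
    have h1 : 1 / C' ≤ h₀ := by
      rw [one_div_le hC'₀ hh₀]; linarith
    have h2 := hline (1 / C') h1 δ hδ hδ₁ P hP ρ hρ hρK ℓ hℓ
    have h3 : volume (ballUnion P ρ ∩ nbhd ℓ (1 / C')) ≠ ⊤ :=
      ne_top_of_le_ne_top hfin (measure_mono inter_subset_left)
    rw [← ENNReal.ofReal_toReal h3, ← ENNReal.ofReal_toReal hfin,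
      show (10 : ENNReal) = ENNReal.ofReal 10 by norm_num,
      ← ENNReal.ofReal_div_of_pos (by norm_num)]
    exact ENNReal.ofReal_le_ofReal h2

theorem mul_rpow_le_mul_rpow {a b κ : ℝ} (ha : 0 < a) (hab : a ≤ b) (hκ : κ ≤ 1) :
    a * b ^ κ ≤ b * a ^ κ := by
  have hb : 0 < b := ha.trans_le hab
  have e : ∀ s : ℝ, 0 < s → s = s ^ κ * s ^ (1 - κ) := fun s hs => by
    rw [← Real.rpow_add hs]; simp
  have h := Real.rpow_le_rpow ha.le hab (by linarith : 0 ≤ 1 - κ)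
  calc a * b ^ κ = a ^ κ * a ^ (1 - κ) * b ^ κ := by rw [← e a ha]
    _ ≤ a ^ κ * b ^ (1 - κ) * b ^ κ := by gcongr
    _ = (b ^ κ * b ^ (1 - κ)) * a ^ κ := by ring
    _ = b * a ^ κ := by rw [← e b hb]

/-- If δ ≤ r₂, the strip is fattened to width h' = max r₁ δ before its mass is measured, but each
ball meets the rectangle in area only about δ * min r₁ δ. If r₂ < δ, the area of the rectangle
itself suffices. -/
theorem IsRegularMeasure.volume_inter_rectangle_le (hν : IsRegularMeasure 1 c C J ν)
    (hD : 0 ≤ D) (hκ₁ : κ ≤ 1)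
    (hslab : ∀ (n : Plane) (t : ℝ) (x : Plane) (h r : ℝ), ‖n‖ = 1 → 0 < h → h ≤ r →
      ν.real (strip n t h ∩ closedBall x r) ≤ D * h ^ κ * r ^ (1 - κ))
    (hK : 1 ≤ K) (hδ : 0 < δ) (hδ₁ : δ ≤ 1) (hP : IsNet J δ P)
    (hρ : δ ≤ ρ) (hρK : ρ ≤ K * δ) {r₁ r₂ : ℝ} (hr₁ : 0 < r₁) (hr : r₁ ≤ r₂) {S : Set Plane}
    (hS : IsRectangle r₁ r₂ S) :
    volume.real (ballUnion P ρ ∩ S) ≤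
      (16 * D * K ^ 2 * (K + 4) * C / c + 16 * C) * r₁ ^ κ * r₂ ^ (1 - κ) *
        volume.real (ballUnion P ρ) := by
  have := hν.prob
  have hC := hν.upper_pos
  have hc := hν.lower_pos
  have hr₂ : 0 < r₂ := hr₁.trans_le hr
  obtain ⟨n, t, x, hn, hsub⟩ := hS.exists_subset_strip_inter_closedBall hr
  set V := volume.real (ballUnion P ρ)
  have hV₀ : 0 ≤ V := measureReal_nonneg
  have hV : δ ≤ 2 * C * V := by
    have h := hν.sq_le_volume_mul hδ hP hρ
    rw [Real.rpow_one] at h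
    refine le_of_mul_le_mul_left ?_ hδ
    calc δ * δ = δ ^ 2 := by ring
      _ ≤ _ := h
      _ = _ := by ring
  rcases le_or_gt δ r₂ with h2 | h2
  · set h' := max r₁ δ
    set m := min r₁ δ
    have hh' : 0 < h' := lt_max_of_lt_left hr₁
    have hm₀ : 0 < m := lt_min hr₁ hδ
    have hδh : δ ≤ h' := le_max_right _ _
    -- When r₁ < δ, the smaller area per ball pays for the fattening of the strip.
    have hmh : m * h' ^ κ ≤ δ * r₁ ^ κ := by
      rcases le_total r₁ δ with h | h
      · simp only [m, h', min_eq_left h, max_eq_right h]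
        exact mul_rpow_le_mul_rpow hr₁ h hκ₁
      · simp only [m, h', min_eq_right h, max_eq_left h]; exact le_rfl
    have hE : ν.real (strip n t ((K + 4) * h') ∩ closedBall x ((K + 4) * r₂)) ≤
        D * (K + 4) * h' ^ κ * r₂ ^ (1 - κ) := by
      refine (hslab n t x _ _ hn (by positivity) ?_).trans_eq ?_
      · exact mul_le_mul_of_nonneg_left (max_le hr h2) (by positivity)
      · rw [Real.mul_rpow (by positivity) hh'.le, Real.mul_rpow (by positivity) hr₂.le]
        have : (K + 4) ^ κ * (K + 4) ^ (1 - κ) = K + 4 := by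
          rw [← Real.rpow_add (by positivity)]; simp
        calc _ = D * ((K + 4) ^ κ * (K + 4) ^ (1 - κ)) * h' ^ κ * r₂ ^ (1 - κ) := by ring
          _ = _ := by rw [this]
    have h1 := hν.volume_inter_mul_le le_rfl hδ hδ₁ hP S
      (strip n t ((K + 4) * h') ∩ closedBall x ((K + 4) * r₂)) (ρ := ρ) (M := 4 * K ^ 2 * δ * m)
      (fun p _ hne z hz => by
        obtain ⟨y, hy, hys⟩ := hne
        have hys' := hsub hys
        rw [mem_closedBall] at hy hz
        have h3 := dist_triangle_right z y p
        have h4 : dist z y ≤ (K + 1) * δ := by linarith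
        have h5 : (K + 1) * δ ≤ (K + 1) * h' := by gcongr
        have h6 : (K + 1) * δ ≤ (K + 1) * r₂ := by gcongr
        have h7 : r₁ ≤ h' := le_max_left _ _
        constructor
        · refine strip_mono n t ?_ (mem_strip_of_dist_le hn hys'.1 h4)
          linarith
        · have h8 := hys'.2
          rw [mem_closedBall] at h8 ⊢
          have h9 := dist_triangle z y x
          linarith)
      (fun p _ => by
        rcases le_total r₁ δ with h | h
        · simp only [m, min_eq_left h]
          have h3 := volume_real_strip_inter_closedBall_le hn t hr₁.le p (hδ.le.trans hρ)
          calc volume.real (closedBall p ρ ∩ S)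
              ≤ volume.real (strip n t r₁ ∩ closedBall p ρ) :=
                measureReal_mono (fun y hy => ⟨(hsub hy.2).1, hy.1⟩)
                  (ne_top_of_le_ne_top (measure_closedBall_ne_top p ρ)
                    (measure_mono inter_subset_right))
            _ ≤ 4 * r₁ * ρ := h3
            _ ≤ 4 * r₁ * (K * δ) := by gcongr
            _ = 4 * K * δ * r₁ := by ring
            _ ≤ 4 * K ^ 2 * δ * r₁ := by gcongr; exact le_self_pow₀ hK two_ne_zero
        · simp only [m, min_eq_right h]
          exact (volume_real_closedBall_inter_le p S hδ hρ hρK).trans_eq (by ring))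
      (by positivity)
    rw [Real.rpow_one] at h1
    refine le_of_mul_le_mul_right ?_ hδ
    calc volume.real (ballUnion P ρ ∩ S) * δ
        ≤ 2 / c * (D * (K + 4) * h' ^ κ * r₂ ^ (1 - κ)) * (4 * K ^ 2 * δ * m) :=
          h1.trans (by gcongr)
      _ = 8 * D * K ^ 2 * (K + 4) / c * r₂ ^ (1 - κ) * δ * (m * h' ^ κ) := by ring
      _ ≤ 8 * D * K ^ 2 * (K + 4) / c * r₂ ^ (1 - κ) * δ * ((2 * C * V) * r₁ ^ κ) := by
          exact mul_le_mul_of_nonneg_left (hmh.trans (by gcongr)) (by positivity)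
      _ = (16 * D * K ^ 2 * (K + 4) * C / c + 0) * r₁ ^ κ * r₂ ^ (1 - κ) * V * δ := by ring
      _ ≤ _ := by gcongr; positivity
  · have h3 := volume_real_strip_inter_closedBall_le hn t hr₁.le x (by positivity : 0 ≤ 2 * r₂)
    have h4 : r₁ ≤ r₁ ^ κ * r₂ ^ (1 - κ) := by
      calc r₁ = r₁ ^ κ * r₁ ^ (1 - κ) := by rw [← Real.rpow_add hr₁]; simp
        _ ≤ r₁ ^ κ * r₂ ^ (1 - κ) := by
            gcongr
    calc volume.real (ballUnion P ρ ∩ S) ≤ volume.real (strip n t r₁ ∩ closedBall x (2 * r₂)) :=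
          measureReal_mono (inter_subset_right.trans hsub)
            (ne_top_of_le_ne_top (measure_closedBall_ne_top x _) (measure_mono inter_subset_right))
      _ ≤ 4 * r₁ * (2 * r₂) := h3
      _ = 8 * (r₁ * r₂) := by ring
      _ ≤ 8 * ((r₁ ^ κ * r₂ ^ (1 - κ)) * (2 * C * V)) := by
          gcongr
          exact h2.le.trans hV
      _ = (0 + 16 * C) * r₁ ^ κ * r₂ ^ (1 - κ) * V := by ring
      _ ≤ _ := by gcongr; positivity

/-- If the measure is one-dimensional and satisfies a slab bound, then the union of the `ρ`-balls
around a net of its support is an unrectifiable one-set. -/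
theorem IsRegularMeasure.exists_isUnrectifiableOneSet (hν : IsRegularMeasure 1 c C J ν)
    (hD : 0 ≤ D) (hκ₀ : 0 < κ) (hκ₁ : κ ≤ 1 / 2)
    (hslab : ∀ (n : Plane) (t : ℝ) (x : Plane) (h r : ℝ), ‖n‖ = 1 → 0 < h → h ≤ r →
      ν.real (strip n t h ∩ closedBall x r) ≤ D * h ^ κ * r ^ (1 - κ))
    (hK : 1 ≤ K) (hR : 0 ≤ R) (hJ : J ⊆ closedBall 0 R) (hne : J.Nonempty)
    (hstrip : ∀ ε : ℝ, 0 < ε → ∃ η : ℝ, 0 < η ∧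
      ∀ (n : Plane) (t : ℝ), ‖n‖ = 1 → ν.real (strip n t η) ≤ ε) :
    ∃ C₀ : ℝ, 0 < C₀ ∧ ∀ C' ≥ C₀, ∀ δ : ℝ, 0 < δ → δ ≤ 1 → ∀ P : Finset Plane, IsNet J δ P →
      ∀ ρ : ℝ, δ ≤ ρ → ρ ≤ K * δ → IsUnrectifiableOneSet κ C' ρ (ballUnion P ρ) := by
  have hC := hν.upper_pos
  have hc := hν.lower_pos
  obtain ⟨C₁, hC₁, h⟩ := hν.exists_isUnconcentrated one_pos le_rfl hK hR hJ hne hstrip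
  refine ⟨C₁ + (16 * D * K ^ 2 * (K + 4) * C / c + 16 * C), by positivity, ?_⟩
  intro C' hC' δ hδ hδ₁ P hP ρ hρ hρK
  have h0 : 0 ≤ 16 * D * K ^ 2 * (K + 4) * C / c + 16 * C := by positivity
  refine ⟨hκ₀, hκ₁, h C' (by linarith) δ hδ hδ₁ P hP ρ hρ hρK, ?_⟩
  intro r₁ r₂ S hr₁ hr hS
  have hr₂ : 0 < r₂ := hr₁.trans_le hr
  have hC'₀ : 0 < C' := by linarith
  refine measure_le_ofReal_mul (by positivity) (volume_ballUnion_ne_top P ρ)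
    (measure_mono inter_subset_left) ?_
  refine (hν.volume_inter_rectangle_le hD (by linarith) hslab hK hδ hδ₁ hP hρ hρK hr₁ hr hS).trans ?_
  gcongr
  linarith

end

/-! ### Similitudes -/

namespace Similitude

theorem dist_map (T : Similitude) (x y : Plane) :
    dist (T.map x) (T.map y) = T.ratio * dist x y := by
  rw [map, map, dist_add_right, dist_smul₀, T.rot.dist_map, Real.norm_of_nonneg T.ratio_pos.le]

theorem injective_map (T : Similitude) : Function.Injective T.map := fun x y h => by
  have h1 := T.dist_map x y
  rw [h, dist_self] at h1
  exact dist_eq_zero.1 ((mul_eq_zero.1 h1.symm).resolve_left T.ratio_pos.ne')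

theorem surjective_map (T : Similitude) : Function.Surjective T.map := fun y =>
  ⟨T.rot.symm (T.ratio⁻¹ • (y - T.shift)), by
    rw [map, T.rot.apply_symm_apply, smul_inv_smul₀ T.ratio_pos.ne', sub_add_cancel]⟩

theorem continuous_map (T : Similitude) : Continuous T.map := by
  unfold map; fun_prop

/-- The composition `x ↦ T (S x)`. -/
noncomputable def comp (T S : Similitude) : Similitude where
  ratio := T.ratio * S.ratio
  ratio_pos := mul_pos T.ratio_pos S.ratio_pos
  ratio_lt_one := mul_lt_one_of_nonneg_of_lt_one_left T.ratio_pos.le T.ratio_lt_one S.ratio_lt_one.le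
  rot := S.rot.trans T.rot
  shift := T.map S.shift

theorem comp_map (T S : Similitude) (x : Plane) : (T.comp S).map x = T.map (S.map x) := by
  simp [comp, map, smul_smul, add_assoc]

/-- Strips are stable under similitudes, with all normals allowed; this is what lets strip estimates
be iterated through the scales. -/
theorem preimage_strip (T : Similitude) {n : Plane} (hn : ‖n‖ = 1) (t h : ℝ) :
    ∃ (n' : Plane) (t' : ℝ), ‖n'‖ = 1 ∧ T.map ⁻¹' strip n t h = strip n' t' (h / T.ratio) := by
  refine ⟨T.rot.symm n, (t - inner ℝ n T.shift) / T.ratio, by simp [hn], ?_⟩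
  ext x
  have hr := T.ratio_pos
  have h1 : inner ℝ (T.rot.symm n) x = inner ℝ n (T.rot x) := by
    rw [← T.rot.inner_map_map, T.rot.apply_symm_apply]
  have h2 : inner ℝ n (T.map x) - t =
      (inner ℝ (T.rot.symm n) x - (t - inner ℝ n T.shift) / T.ratio) * T.ratio := by
    rw [h1, map, inner_add_right, inner_smul_right]
    field_simp
    ring
  simp only [strip, mem_preimage, mem_ofPred_eq]
  rw [h2, abs_mul, abs_of_pos hr, le_div_iff₀ hr]

end Similitude

/-! ### The self-similar measure -/

section

variable {s : ℕ}

theorem measurable_cons : Measurable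
    (fun q : Fin s × (ℕ → Fin s) => fun k : ℕ => (Nat.casesOn k q.1 q.2 : Fin s)) := by
  refine measurable_pi_lambda _ fun k => ?_
  cases k with
  | zero => exact measurable_fst
  | succ k => exact (measurable_pi_apply k).comp measurable_snd

/-- Prepending an independent letter to an i.i.d. sequence leaves its law unchanged. Pushed forward
by the coding map, this becomes the self-similarity of the measure. -/
theorem infinitePi_eq_map_cons (p : Measure (Fin s)) [IsProbabilityMeasure p] :
    Measure.infinitePi (fun _ : ℕ => p) =
      (p.prod (Measure.infinitePi (fun _ : ℕ => p))).map
        (fun q : Fin s × (ℕ → Fin s) => fun k : ℕ => Nat.casesOn k q.1 q.2) := by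
  classical
  symm
  have hmeas := measurable_cons (s := s)
  refine Measure.eq_infinitePi _ fun F t ht => ?_
  rw [Measure.map_apply hmeas (MeasurableSet.pi F.countable_toSet fun i _ => ht i)]
  set G : Finset ℕ := F.preimage Nat.succ (Nat.succ_injective.injOn)
  have hset : (fun q : Fin s × (ℕ → Fin s) => fun k : ℕ => (Nat.casesOn k q.1 q.2 : Fin s)) ⁻¹'
      Set.pi F t = (if 0 ∈ F then t 0 else univ) ×ˢ Set.pi G (fun k => t (k + 1)) := by
    ext ⟨i, ξ⟩
    simp only [mem_preimage, Set.mem_pi, mem_prod, Finset.mem_coe, G, Finset.mem_preimage]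
    constructor
    · intro h
      refine ⟨?_, fun k hk => h (k + 1) hk⟩
      split_ifs with h0
      · exact h 0 h0
      · trivial
    · rintro ⟨h0, h1⟩ k hk
      cases k with
      | zero => simpa [hk] using h0
      | succ k => exact h1 k hk
  rw [hset, Measure.prod_prod, Measure.infinitePi_pi _ (fun i _ => ht _)]
  have hprod : ∏ k ∈ G, p (t (k + 1)) = ∏ k ∈ F.erase 0, p (t k) := by
    refine Finset.prod_bij (fun k _ => k + 1) ?_ ?_ ?_ ?_
    · intro k hk
      exact Finset.mem_erase.2 ⟨by omega, by simpa [G] using hk⟩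
    · intro a _ b _ h; omega
    · intro b hb
      obtain ⟨hb0, hb⟩ := Finset.mem_erase.1 hb
      obtain ⟨k, rfl⟩ := Nat.exists_eq_succ_of_ne_zero hb0
      exact ⟨k, by simpa [G] using hb, rfl⟩
    · intros; rfl
  rw [hprod]
  split_ifs with h0
  · rw [Finset.mul_prod_erase F (fun k => p (t k)) h0]
  · rw [measure_univ, one_mul, Finset.erase_eq_of_notMem h0]

/-- The approximations of the coding map, started from `x₀`. -/
noncomputable def codingApprox (T : Fin s → Similitude) (x₀ : Plane) :
    ℕ → (ℕ → Fin s) → Plane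
  | 0, _ => x₀
  | k + 1, ξ => (T (ξ 0)).map (codingApprox T x₀ k fun j => ξ (j + 1))

theorem measurable_codingApprox (T : Fin s → Similitude) (x₀ : Plane) (k : ℕ) :
    Measurable (codingApprox T x₀ k) := by
  induction k with
  | zero => exact measurable_const
  | succ k ih =>
    have h1 : Measurable (fun q : Fin s × Plane => (T q.1).map q.2) :=
      measurable_from_prod_countable_right fun i => (T i).continuous_map.measurable
    have h2 : Measurable (fun ξ : ℕ → Fin s => fun j => ξ (j + 1)) :=
      measurable_pi_lambda _ fun j => measurable_pi_apply _
    exact h1.comp ((measurable_pi_apply 0).prodMk (ih.comp h2))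

theorem codingApprox_mem {T : Fin s → Similitude} {J : Set Plane}
    (hT : ∀ i, ∀ x ∈ J, (T i).map x ∈ J) {x₀ : Plane} (hx₀ : x₀ ∈ J) (k : ℕ) (ξ : ℕ → Fin s) :
    codingApprox T x₀ k ξ ∈ J := by
  induction k generalizing ξ with
  | zero => exact hx₀
  | succ k ih => exact hT _ _ (ih _)

theorem dist_codingApprox_le {T : Fin s → Similitude} {J : Set Plane}
    (hJ : Bornology.IsBounded J)
    (hT : ∀ i, ∀ x ∈ J, (T i).map x ∈ J) {x₀ : Plane} (hx₀ : x₀ ∈ J) {lam : ℝ}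
    (hlam : ∀ i, (T i).ratio ≤ lam) (k : ℕ) (ξ : ℕ → Fin s) :
    dist (codingApprox T x₀ k ξ) (codingApprox T x₀ (k + 1) ξ) ≤ diam J * lam ^ k := by
  induction k generalizing ξ with
  | zero =>
    rw [pow_zero, mul_one]
    exact dist_le_diam_of_mem hJ (codingApprox_mem hT hx₀ _ _) (codingApprox_mem hT hx₀ _ _)
  | succ k ih =>
    have h0 : 0 ≤ lam := (T (ξ 0)).ratio_pos.le.trans (hlam _)
    calc dist (codingApprox T x₀ (k + 1) ξ) (codingApprox T x₀ (k + 1 + 1) ξ)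
        = (T (ξ 0)).ratio * dist (codingApprox T x₀ k fun j => ξ (j + 1))
            (codingApprox T x₀ (k + 1) fun j => ξ (j + 1)) := by
          rw [← Similitude.dist_map]; rfl
      _ ≤ lam * (diam J * lam ^ k) := mul_le_mul (hlam _) (ih _) dist_nonneg h0
      _ = diam J * lam ^ (k + 1) := by ring

theorem exists_ratio_le (T : Fin s → Similitude) : ∃ lam : ℝ, 0 < lam ∧ lam < 1 ∧
    ∀ i, (T i).ratio ≤ lam := by
  rcases isEmpty_or_nonempty (Fin s) with h | h
  · exact ⟨1 / 2, by norm_num, by norm_num, fun i => h.elim i⟩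
  · obtain ⟨i, hi⟩ := Finite.exists_max fun i => (T i).ratio
    exact ⟨_, (T i).ratio_pos, (T i).ratio_lt_one, hi⟩

theorem exists_le_ratio (T : Fin s → Similitude) : ∃ lam : ℝ, 0 < lam ∧ lam < 1 ∧
    ∀ i, lam ≤ (T i).ratio := by
  rcases isEmpty_or_nonempty (Fin s) with h | h
  · exact ⟨1 / 2, by norm_num, by norm_num, fun i => h.elim i⟩
  · obtain ⟨i, hi⟩ := Finite.exists_min fun i => (T i).ratio
    exact ⟨_, (T i).ratio_pos, (T i).ratio_lt_one, hi⟩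

/-- The approximations are geometrically Cauchy because every letter contracts by a uniform factor;
the recursion survives the limit by continuity. -/
theorem exists_codingMap {T : Fin s → Similitude} {J : Set Plane} (hJ : IsCompact J)
    (hne : J.Nonempty) (hT : ∀ i, ∀ x ∈ J, (T i).map x ∈ J) :
    ∃ π : (ℕ → Fin s) → Plane, Measurable π ∧ (∀ ξ, π ξ ∈ J) ∧
      ∀ ξ, π ξ = (T (ξ 0)).map (π fun j => ξ (j + 1)) := by
  obtain ⟨x₀, hx₀⟩ := hne
  obtain ⟨lam, h0, h1, hlam⟩ := exists_ratio_le T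
  have hlim : ∀ ξ, ∃ y, Tendsto (fun k => codingApprox T x₀ k ξ) atTop (𝓝 y) := fun ξ =>
    cauchySeq_tendsto_of_complete
      (cauchySeq_of_le_geometric lam (diam J) h1
        fun k => dist_codingApprox_le hJ.isBounded hT hx₀ hlam k ξ)
  choose π hπ using hlim
  refine ⟨π, measurable_of_tendsto_metrizable (fun k => measurable_codingApprox T x₀ k)
    (tendsto_pi_nhds.2 hπ), fun ξ => hJ.isClosed.mem_of_tendsto (hπ ξ)
      (Eventually.of_forall fun k => codingApprox_mem hT hx₀ k ξ), fun ξ => ?_⟩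
  refine tendsto_nhds_unique ((tendsto_add_atTop_iff_nat 1).2 (hπ ξ)) ?_
  exact ((T (ξ 0)).continuous_map.tendsto _).comp (hπ fun j => ξ (j + 1))

/-- Existence of the self-similar measure with given weights. -/
theorem exists_selfSimilar_measure {T : Fin s → Similitude} {J : Set Plane} (hJ : IsCompact J)
    (hne : J.Nonempty) (hT : ∀ i, ∀ x ∈ J, (T i).map x ∈ J) (w : Fin s → ℝ) (hw : ∀ i, 0 ≤ w i)
    (hsum : ∑ i, w i = 1) :
    ∃ ν : Measure Plane, IsProbabilityMeasure ν ∧ ν Jᶜ = 0 ∧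
      ∀ E : Set Plane, MeasurableSet E → ν.real E = ∑ i, w i * ν.real ((T i).map ⁻¹' E) := by
  classical
  obtain ⟨π, hπm, hπJ, hπ⟩ := exists_codingMap hJ hne hT
  let p : Measure (Fin s) := ∑ i, ENNReal.ofReal (w i) • Measure.dirac i
  have hp : IsProbabilityMeasure p := by
    constructor
    simp only [p, Measure.coe_finsetSum, Finset.sum_apply, Measure.smul_apply, measure_univ,
      smul_eq_mul, mul_one]
    rw [← ENNReal.ofReal_sum_of_nonneg fun i _ => hw i, hsum, ENNReal.ofReal_one]
  have hpi : ∀ i, p {i} = ENNReal.ofReal (w i) := by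
    intro i
    simp only [p, Measure.coe_finsetSum, Finset.sum_apply, Measure.smul_apply, smul_eq_mul]
    rw [Finset.sum_eq_single i]
    · simp
    · intro j _ hj; simp [hj]
    · simp
  set Pr := Measure.infinitePi (fun _ : ℕ => p)
  have hν : IsProbabilityMeasure (Pr.map π) := Measure.isProbabilityMeasure_map hπm.aemeasurable
  refine ⟨Pr.map π, hν, ?_, fun E hE => ?_⟩
  · rw [Measure.map_apply hπm hJ.isClosed.measurableSet.compl]
    convert! measure_empty (μ := Pr)
    ext ξ; simp [hπJ ξ]
  have hmeas := measurable_cons (s := s)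
  have key : (Pr.map π) E = ∑ i, ENNReal.ofReal (w i) * (Pr.map π) ((T i).map ⁻¹' E) := by
    rw [Measure.map_apply hπm hE]
    conv_lhs => rw [show Pr = _ from infinitePi_eq_map_cons p]
    rw [Measure.map_apply hmeas (hπm hE), Measure.prod_apply (hmeas (hπm hE)), lintegral_fintype]
    refine Finset.sum_congr rfl fun i _ => ?_
    rw [hpi, mul_comm, Measure.map_apply hπm ((T i).continuous_map.measurable hE)]
    congr 2
    ext ξ
    simp only [mem_preimage]
    rw [hπ]
    exact Iff.rfl
  rw [Measure.real, key, ENNReal.toReal_sum fun i _ =>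
    ENNReal.mul_ne_top ENNReal.ofReal_ne_top (measure_ne_top _ _)]
  refine Finset.sum_congr rfl fun i _ => ?_
  rw [ENNReal.toReal_mul, ENNReal.toReal_ofReal (hw i)]
  rfl

end

/-! ### Decompositions of a self-similar set into pieces of comparable size -/

/-- The similitudes `S j` decompose the set `J₀` into copies of `J` and the mass distribution `m`
into copies of `ν`, and they map `O` to pairwise disjoint subsets of `O₀`. -/
structure IsDecomposition (D : ℝ) (J O : Set Plane) (ν : Measure Plane) (m : Set Plane → ℝ)
    (J₀ O₀ : Set Plane) {ι : Type} [Fintype ι] (S : ι → Similitude) : Prop where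
  mass : ∀ E : Set Plane, MeasurableSet E →
    m E = ∑ j, (S j).ratio ^ D * ν.real ((S j).map ⁻¹' E)
  cover : J₀ = ⋃ j, (S j).map '' J
  maps : ∀ j, (S j).map '' O ⊆ O₀
  disj : ∀ i j, i ≠ j → Disjoint ((S i).map '' O) ((S j).map '' O)

section

variable {D lam r : ℝ} {J O J₀ O₀ : Set Plane} {ν : Measure Plane} {m : Set Plane → ℝ}

theorem isDecomposition_unit (A : Similitude) :
    IsDecomposition D J O ν (fun E => A.ratio ^ D * ν.real (A.map ⁻¹' E)) (A.map '' J)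
      (A.map '' O) (fun _ : Unit => A) where
  mass _ _ := by
    simp only [Finset.sum_const, Finset.card_univ, Fintype.card_unit, one_smul]
  cover := (iUnion_const _).symm
  maps _ := Subset.rfl
  disj i j h := absurd (Subsingleton.elim i j) h

theorem IsDecomposition.comp {ι : Type} [Fintype ι] {S : ι → Similitude}
    (hS : IsDecomposition D J O ν ν.real J O S) (A : Similitude) :
    IsDecomposition D J O ν (fun E => A.ratio ^ D * ν.real (A.map ⁻¹' E)) (A.map '' J)
      (A.map '' O) (fun j => A.comp (S j)) := by
  have himg : ∀ (j : ι) (X : Set Plane),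
      (A.comp (S j)).map '' X = A.map '' ((S j).map '' X) := fun j X => by
    rw [image_image]; simp only [Similitude.comp_map]
  refine ⟨fun E hE => ?_, ?_, fun j => ?_, fun i j hij => ?_⟩
  · rw [hS.mass _ (A.continuous_map.measurable hE), Finset.mul_sum]
    refine Finset.sum_congr rfl fun j _ => ?_
    have h1 : (A.comp (S j)).map ⁻¹' E = (S j).map ⁻¹' (A.map ⁻¹' E) := by
      ext x; simp [Similitude.comp_map]
    rw [h1, ← mul_assoc, ← Real.mul_rpow A.ratio_pos.le (S j).ratio_pos.le]
    rfl
  · conv_lhs => rw [hS.cover]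
    simp only [himg, image_iUnion]
  · rw [himg]; exact image_mono (hS.maps j)
  · rw [himg, himg]
    exact (disjoint_image_iff A.injective_map).2 (hS.disj i j hij)

/-- Each piece may be refined by its own decomposition. Stopping at a prescribed size needs this,
since the ratios differ and pieces reach that size at different depths. -/
theorem IsDecomposition.sigma {ι : Type} [Fintype ι] {S : ι → Similitude}
    (hS : IsDecomposition D J O ν m J₀ O₀ S) {κ : ι → Type} [∀ i, Fintype (κ i)]
    {R : ∀ i, κ i → Similitude}
    (hR : ∀ i, IsDecomposition D J O ν
      (fun E => (S i).ratio ^ D * ν.real ((S i).map ⁻¹' E)) ((S i).map '' J) ((S i).map '' O)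
      (R i)) :
    IsDecomposition D J O ν m J₀ O₀ (fun q : Σ i, κ i => R q.1 q.2) := by
  refine ⟨fun E hE => ?_, ?_, fun q => ((hR q.1).maps q.2).trans (hS.maps q.1), ?_⟩
  · rw [hS.mass E hE, Fintype.sum_sigma]
    exact Finset.sum_congr rfl fun i _ => (hR i).mass E hE
  · rw [hS.cover, iUnion_sigma]
    exact iUnion_congr fun i => (hR i).cover
  · rintro ⟨i, j⟩ ⟨i', j'⟩ hne
    by_cases h : i = i'
    · subst h
      exact (hR i).disj j j' fun h => hne (by rw [h])
    · exact (hS.disj i i' h).mono ((hR i).maps j) ((hR i').maps j')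

/-- Every scale `r < 1` has a decomposition into pieces of size comparable to `r`. -/
theorem IsDecomposition.exists_scale {s : ℕ} {T : Fin s → Similitude}
    (hT : IsDecomposition D J O ν ν.real J O T) (hlam₀ : 0 < lam)
    (hlam : ∀ i, lam ≤ (T i).ratio) (hr₀ : 0 < r) (hr₁ : r < 1) :
    ∃ (ι : Type) (_ : Fintype ι) (S : ι → Similitude),
      IsDecomposition D J O ν ν.real J O S ∧
      ∀ j, lam * r ≤ (S j).ratio ∧ (S j).ratio ≤ r := by
  obtain ⟨b, hb₀, hb₁, hb⟩ := exists_ratio_le T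
  -- The induction is on k with b ^ k ≤ r: inside the i-th piece the relative scale is r / ratio,
  -- for which k - 1 is enough.
  obtain ⟨k, hk⟩ : ∃ k : ℕ, b ^ k ≤ r := by
    obtain ⟨k, hk⟩ := exists_pow_lt_of_lt_one hr₀ hb₁
    exact ⟨k, hk.le⟩
  induction k generalizing r with
  | zero => rw [pow_zero] at hk; linarith
  | succ k ih =>
    have key : ∀ i, ∃ (ι : Type) (_ : Fintype ι) (R : ι → Similitude),
        IsDecomposition D J O ν
          (fun E => (T i).ratio ^ D * ν.real ((T i).map ⁻¹' E)) ((T i).map '' J)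
          ((T i).map '' O) R ∧ ∀ j, lam * r ≤ (R j).ratio ∧ (R j).ratio ≤ r := by
      intro i
      have hi := (T i).ratio_pos
      rcases le_or_gt (T i).ratio r with h | h
      · refine ⟨Unit, inferInstance, fun _ => T i, isDecomposition_unit _, fun _ => ⟨?_, h⟩⟩
        exact (mul_le_of_le_one_right hlam₀.le hr₁.le).trans (hlam i)
      · obtain ⟨ι, hι, S, hS, hSr⟩ := ih (r := r / (T i).ratio) (by positivity)
          ((div_lt_one hi).2 h) (by
            rw [le_div_iff₀ hi]
            calc b ^ k * (T i).ratio ≤ b ^ k * b := by gcongr; exact hb i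
              _ = b ^ (k + 1) := by ring
              _ ≤ r := hk)
        refine ⟨ι, hι, fun j => (T i).comp (S j), hS.comp _, fun j => ?_⟩
        obtain ⟨h1, h2⟩ := hSr j
        change lam * r ≤ (T i).ratio * (S j).ratio ∧ (T i).ratio * (S j).ratio ≤ r
        rw [← mul_div_assoc, div_le_iff₀ hi] at h1
        rw [le_div_iff₀ hi] at h2
        constructor <;> linarith
    choose κ hκ R hR hRr using key
    exact ⟨Σ i, κ i, inferInstance, fun q => R q.1 q.2, hT.sigma hR, fun q => hRr q.1 q.2⟩

theorem IsDecomposition.sum_ratio_rpow [IsProbabilityMeasure ν] {ι : Type} [Fintype ι]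
    {S : ι → Similitude} (hS : IsDecomposition D J O ν ν.real J O S) :
    ∑ j, (S j).ratio ^ D = 1 := by
  have h := hS.mass univ MeasurableSet.univ
  simpa using h.symm

theorem IsDecomposition.mem_of_mem {ι : Type} [Fintype ι] {S : ι → Similitude}
    (hS : IsDecomposition D J O ν m J O₀ S) (j : ι) {x : Plane} (hx : x ∈ J) :
    (S j).map x ∈ J := by
  rw [hS.cover]
  exact mem_iUnion.2 ⟨j, mem_image_of_mem _ hx⟩

/-- The number of pieces of size `r` that meet a ball of radius `r` is bounded. -/
theorem IsDecomposition.exists_card_le (hJ : Bornology.IsBounded J) (hO : IsOpen O)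
    (hOne : O.Nonempty) (hlam₀ : 0 < lam) :
    ∃ N : ℝ, 0 < N ∧ ∀ (m : Set Plane → ℝ) (J₀ O₀ : Set Plane) (ι : Type) (_ : Fintype ι)
      (S : ι → Similitude), IsDecomposition D J O ν m J₀ O₀ S → ∀ r : ℝ, 0 < r →
      (∀ j, lam * r ≤ (S j).ratio ∧ (S j).ratio ≤ r) → ∀ (x : Plane) (F : Finset ι),
      (∀ j ∈ F, ∃ y ∈ J, (S j).map y ∈ closedBall x r) → (F.card : ℝ) ≤ N := by
  obtain ⟨x₀, hx₀⟩ := hOne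
  obtain ⟨ρ, hρ, hball⟩ := nhds_basis_closedBall.mem_iff.1 (hO.mem_nhds hx₀)
  obtain ⟨M, hM, hJM⟩ := hJ.subset_closedBall_lt 0 x₀
  set c := lam * ρ
  have hc : 0 < c := by positivity
  refine ⟨(M + 1 + c) ^ 2 / c ^ 2, by positivity, ?_⟩
  intro m J₀ O₀ ι _ S hS r hr hSr x F hF
  -- The lower bound on the ratios gives every copy of O a ball of radius c * r; these are disjoint,
  -- so packing applies.
  have hin : ∀ j, closedBall ((S j).map x₀) (c * r) ⊆ (S j).map '' O := by
    intro j y hy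
    obtain ⟨z, rfl⟩ := (S j).surjective_map y
    refine mem_image_of_mem _ (hball ?_)
    rw [mem_closedBall, Similitude.dist_map] at hy
    rw [mem_closedBall]
    refine le_of_mul_le_mul_left (hy.trans ?_) (S j).ratio_pos
    calc c * r = lam * r * ρ := by ring
      _ ≤ (S j).ratio * ρ := by gcongr; exact (hSr j).1
  have h := card_mul_sq_le F (fun j => (S j).map x₀) (ρ := c * r) (R := (M + 1) * r)
    (by positivity) (by positivity) x
    (fun i _ j _ hij => (hS.disj i j hij).mono (hin i) (hin j))
    (fun j hj => by
      obtain ⟨y, hyJ, hy⟩ := hF j hj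
      have h1 := dist_triangle ((S j).map x₀) ((S j).map y) x
      rw [Similitude.dist_map, dist_comm x₀] at h1
      have h2 : (S j).ratio * dist y x₀ ≤ r * M :=
        mul_le_mul (hSr j).2 (hJM hyJ) dist_nonneg hr.le
      rw [mem_closedBall] at hy
      linarith)
  rw [le_div_iff₀ (by positivity)]
  have hr2 : 0 < r ^ 2 := by positivity
  refine le_of_mul_le_mul_right ?_ hr2
  calc (F.card : ℝ) * c ^ 2 * r ^ 2 = F.card * (c * r) ^ 2 := by ring
    _ ≤ ((M + 1) * r + c * r) ^ 2 := h
    _ = (M + 1 + c) ^ 2 * r ^ 2 := by ring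

theorem measureReal_preimage_eq_zero (hν : ν Jᶜ = 0) (A : Similitude) {E : Set Plane}
    (h : ∀ y ∈ J, A.map y ∉ E) : ν.real (A.map ⁻¹' E) = 0 := by
  have hsub : A.map ⁻¹' E ⊆ Jᶜ := fun y hy hyJ => h y hyJ hy
  rw [Measure.real, measure_mono_null hsub hν, ENNReal.toReal_zero]

/-- Self-similar measures of systems with the open set condition are regular. -/
theorem IsDecomposition.exists_isRegularMeasure [hprob : IsProbabilityMeasure ν] {s : ℕ}
    {T : Fin s → Similitude} (hT : IsDecomposition D J O ν ν.real J O T) (hD : 0 ≤ D)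
    (hν : ν Jᶜ = 0) (hJ : Bornology.IsBounded J) (hO : IsOpen O) (hOne : O.Nonempty) :
    ∃ c C : ℝ, IsRegularMeasure D c C J ν := by
  classical
  obtain ⟨lam, hlam₀, hlam₁, hlam⟩ := exists_le_ratio T
  obtain ⟨N, hN, hcard⟩ := IsDecomposition.exists_card_le (D := D) (ν := ν) hJ hO hOne hlam₀
  have hd := diam_nonneg (s := J)
  refine ⟨(lam / (diam J + 2)) ^ D, N + 1, hprob, hν, by positivity, by positivity, ?_, ?_⟩
  · intro x r hr
    rcases lt_or_ge r 1 with h1 | h1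
    · obtain ⟨ι, _, S, hS, hSr⟩ := hT.exists_scale hlam₀ hlam hr h1
      set F : Finset ι := Finset.univ.filter fun j => ∃ y ∈ J, (S j).map y ∈ closedBall x r
      have hF := hcard _ _ _ ι _ S hS r hr hSr x F (fun j hj => (Finset.mem_filter.1 hj).2)
      rw [hS.mass _ measurableSet_closedBall]
      calc ∑ j, (S j).ratio ^ D * ν.real ((S j).map ⁻¹' closedBall x r)
          = ∑ j ∈ F, (S j).ratio ^ D * ν.real ((S j).map ⁻¹' closedBall x r) := by
            refine (Finset.sum_subset (Finset.subset_univ F) fun j _ hj => ?_).symm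
            rw [measureReal_preimage_eq_zero hν, mul_zero]
            intro y hy hyE
            exact hj (Finset.mem_filter.2 ⟨Finset.mem_univ _, y, hy, hyE⟩)
        _ ≤ ∑ j ∈ F, r ^ D * 1 := by
            refine Finset.sum_le_sum fun j _ => mul_le_mul ?_ measureReal_le_one
              measureReal_nonneg (by positivity)
            exact Real.rpow_le_rpow (S j).ratio_pos.le (hSr j).2 hD
        _ = F.card * r ^ D := by simp
        _ ≤ (N + 1) * r ^ D := by gcongr; linarith
    · calc ν.real (closedBall x r) ≤ 1 := measureReal_le_one
        _ ≤ 1 * r ^ D := by rw [one_mul]; exact Real.one_le_rpow h1 hD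
        _ ≤ (N + 1) * r ^ D := by gcongr; linarith
  · intro x hx r hr hr1
    -- A piece of ratio at most r' containing x lies inside the r-ball. Adding 2 keeps r' < 1 even
    -- if r = 1 and J is a point.
    set r' := r / (diam J + 2)
    have hr' : 0 < r' := by positivity
    have hr'1 : r' < 1 := by
      rw [div_lt_one (by positivity)]; linarith
    obtain ⟨ι, _, S, hS, hSr⟩ := hT.exists_scale hlam₀ hlam hr' hr'1
    have hx' := hx
    rw [hS.cover, mem_iUnion] at hx'
    obtain ⟨j, y, hy, rfl⟩ := hx'
    have hsub : J ⊆ (S j).map ⁻¹' closedBall ((S j).map y) r := by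
      intro z hz
      rw [mem_preimage, mem_closedBall, Similitude.dist_map]
      calc (S j).ratio * dist z y ≤ r' * (diam J + 2) :=
            mul_le_mul (hSr j).2 ((dist_le_diam_of_mem hJ hz hy).trans (by linarith))
              dist_nonneg hr'.le
        _ = r := by simp only [r']; field_simp
    have hone : ν.real ((S j).map ⁻¹' closedBall ((S j).map y) r) = 1 := by
      refine le_antisymm measureReal_le_one ?_
      have h1 : (1 : ENNReal) ≤ ν ((S j).map ⁻¹' closedBall ((S j).map y) r) := by
        rw [← measure_univ (μ := ν), ← union_compl_self J]
        refine (measure_union_le _ _).trans ?_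
        rw [hν, add_zero]
        exact measure_mono hsub
      rw [Measure.real, ← ENNReal.toReal_one]
      exact ENNReal.toReal_mono (measure_ne_top _ _) h1
    rw [hS.mass _ measurableSet_closedBall]
    calc (lam / (diam J + 2)) ^ D * r ^ D = (lam * r') ^ D := by
          rw [← Real.mul_rpow (by positivity) hr.le]
          congr 1; simp only [r']; ring
      _ ≤ (S j).ratio ^ D * 1 := by
          rw [mul_one]; exact Real.rpow_le_rpow (by positivity) (hSr j).1 hD
      _ = (S j).ratio ^ D * ν.real ((S j).map ⁻¹' closedBall ((S j).map y) r) := by rw [hone]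
      _ ≤ ∑ i, (S i).ratio ^ D * ν.real ((S i).map ⁻¹' closedBall ((S j).map y) r) :=
          Finset.single_le_sum
            (f := fun i => (S i).ratio ^ D * ν.real ((S i).map ⁻¹' closedBall ((S j).map y) r))
            (fun i _ => mul_nonneg (Real.rpow_nonneg (S i).ratio_pos.le _) measureReal_nonneg)
            (Finset.mem_univ j)

end

/-! ### The Hausdorff dimension of a self-similar set -/

section

variable {D c C : ℝ} {J O : Set Plane} {ν : Measure Plane}

/-- The mass distribution principle: a set of diameter d has ν-mass at most C * d ^ D, so ν is
dominated by a multiple of Hausdorff measure. -/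
theorem IsRegularMeasure.le_dimH (hν : IsRegularMeasure D c C J ν) (hD : 0 ≤ D) :
    ENNReal.ofReal D ≤ dimH J := by
  have := hν.prob
  have hC := hν.upper_pos
  have key : (ENNReal.ofReal C)⁻¹ • ν ≤ μH[D] := by
    refine Measure.le_hausdorffMeasure D _ 1 one_pos fun E hE => ?_
    have hfin : ediam E ≠ ⊤ := ne_top_of_le_ne_top ENNReal.one_ne_top hE
    rcases E.eq_empty_or_nonempty with rfl | ⟨x, hx⟩
    · simp
    have hb : Bornology.IsBounded E := isBounded_iff_ediam_ne_top.2 hfin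
    have h1 : ν.real E ≤ C * diam E ^ D := by
      -- Radii slightly above the diameter are used, because the diameter may be zero.
      have hcont : Tendsto (fun r : ℝ => C * r ^ D) (𝓝[>] diam E) (𝓝 (C * diam E ^ D)) :=
        ((Real.continuousAt_rpow_const _ _ (Or.inr hD)).tendsto.mono_left
          nhdsWithin_le_nhds).const_mul C
      refine ge_of_tendsto hcont ?_
      filter_upwards [self_mem_nhdsWithin] with r hr
      have hr' : diam E < r := hr
      refine le_trans (measureReal_mono fun y hy => ?_)
        (hν.upper x r (diam_nonneg.trans_lt hr'))
      exact (dist_le_diam_of_mem hb hy hx).trans hr'.le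
    rw [Measure.smul_apply, smul_eq_mul, ENNReal.inv_mul_le_iff (by simpa using hC) (by simp)]
    rw [← ENNReal.ofReal_toReal (measure_ne_top ν E)]
    calc ENNReal.ofReal (ν E).toReal ≤ ENNReal.ofReal (C * diam E ^ D) :=
          ENNReal.ofReal_le_ofReal h1
      _ = ENNReal.ofReal C * ediam E ^ D := by
          rw [ENNReal.ofReal_mul hC.le, ← ENNReal.ofReal_rpow_of_nonneg diam_nonneg hD, diam,
            ENNReal.ofReal_toReal hfin]
  have hJ : ν J = 1 := by
    refine le_antisymm prob_le_one ?_
    rw [← measure_univ (μ := ν), ← union_compl_self J]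
    refine (measure_union_le _ _).trans ?_
    rw [hν.compl, add_zero]
  have h2 : μH[D] J ≠ 0 := by
    intro h0
    have h3 := key J
    rw [h0, Measure.smul_apply, hJ, smul_eq_mul, mul_one] at h3
    simp at h3
  have h4 : μH[(D.toNNReal : ℝ)] J ≠ 0 := by rwa [Real.coe_toNNReal D hD]
  exact le_dimH_of_hausdorffMeasure_ne_zero h4

/-- The weights of a decomposition sum to one, so covering by its pieces costs at most `diam J ^ D`
at every scale. -/
theorem IsDecomposition.dimH_le [IsProbabilityMeasure ν] {s : ℕ}
    {T : Fin s → Similitude} (hT : IsDecomposition D J O ν ν.real J O T) (hD : 0 ≤ D)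
    (hJ : Bornology.IsBounded J) : dimH J ≤ ENNReal.ofReal D := by
  obtain ⟨lam, hlam₀, -, hlam⟩ := exists_le_ratio T
  have hex : ∀ k : ℕ, ∃ (ι : Type) (_ : Fintype ι) (S : ι → Similitude),
      IsDecomposition D J O ν ν.real J O S ∧
      ∀ j, lam * (1 / ((k : ℝ) + 2)) ≤ (S j).ratio ∧ (S j).ratio ≤ 1 / ((k : ℝ) + 2) := fun k =>
    hT.exists_scale hlam₀ hlam (by positivity) (by
      rw [div_lt_one (by positivity)]
      have : (0 : ℝ) ≤ k := Nat.cast_nonneg k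
      linarith)
  choose ι hι S hS hSr using hex
  have hdiam : ∀ (A : Similitude), ediam (A.map '' J) ≤ ENNReal.ofReal (A.ratio * diam J) := by
    intro A
    refine ediam_le ?_
    rintro _ ⟨x, hx, rfl⟩ _ ⟨y, hy, rfl⟩
    rw [edist_dist, A.dist_map]
    exact ENNReal.ofReal_le_ofReal
      (mul_le_mul_of_nonneg_left (dist_le_diam_of_mem hJ hx hy) A.ratio_pos.le)
  have hlim : Tendsto (fun k : ℕ => ENNReal.ofReal (1 / ((k : ℝ) + 2) * diam J)) atTop (𝓝 0) := by
    rw [← ENNReal.ofReal_zero]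
    refine ENNReal.tendsto_ofReal ?_
    have h1 : Tendsto (fun k : ℕ => 1 / ((k : ℝ) + 2)) atTop (𝓝 0) := by
      have := (tendsto_natCast_atTop_atTop (R := ℝ)).atTop_add (tendsto_const_nhds (x := (2 : ℝ)))
      simpa only [one_div, Function.comp_def] using tendsto_inv_atTop_zero.comp this
    simpa using h1.mul_const (diam J)
  have hH := Measure.hausdorffMeasure_le_liminf_sum D J (l := atTop) _ hlim
    (fun k j => (S k j).map '' J)
    (Eventually.of_forall fun k j => (hdiam _).trans (ENNReal.ofReal_le_ofReal
      (mul_le_mul_of_nonneg_right (hSr k j).2 diam_nonneg)))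
    (Eventually.of_forall fun k => ((hS k).cover).subset)
  have hbound : ∀ k, ∑ j, ediam ((S k j).map '' J) ^ D ≤ ENNReal.ofReal (diam J ^ D) := by
    intro k
    calc ∑ j, ediam ((S k j).map '' J) ^ D
        ≤ ∑ j, ENNReal.ofReal ((S k j).ratio ^ D * diam J ^ D) := by
          refine Finset.sum_le_sum fun j _ => ?_
          rw [← Real.mul_rpow (S k j).ratio_pos.le diam_nonneg,
            ← ENNReal.ofReal_rpow_of_nonneg (mul_nonneg (S k j).ratio_pos.le diam_nonneg) hD]
          exact ENNReal.rpow_le_rpow (hdiam _) hD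
      _ = ENNReal.ofReal (diam J ^ D) := by
          rw [← ENNReal.ofReal_sum_of_nonneg fun j _ => mul_nonneg
              (Real.rpow_nonneg (S k j).ratio_pos.le _) (Real.rpow_nonneg diam_nonneg _),
            ← Finset.sum_mul, (hS k).sum_ratio_rpow, one_mul]
  have hfin : μH[D] J ≠ ⊤ := by
    refine ne_top_of_le_ne_top (ENNReal.ofReal_ne_top (r := diam J ^ D)) (hH.trans ?_)
    refine (liminf_le_liminf (Eventually.of_forall hbound)).trans ?_
    rw [liminf_const]
  have h4 : μH[(D.toNNReal : ℝ)] J ≠ ⊤ := by rwa [Real.coe_toNNReal D hD]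
  exact dimH_le_of_hausdorffMeasure_ne_top h4

/-- The similarity dimension exists. -/
theorem exists_sum_ratio_rpow_eq_one {s : ℕ} [Nonempty (Fin s)] (T : Fin s → Similitude) :
    ∃ D : ℝ, 0 ≤ D ∧ ∑ i, (T i).ratio ^ D = 1 := by
  have hcont : Continuous fun t : ℝ => ∑ i, (T i).ratio ^ t :=
    continuous_finsetSum _ fun i _ => Real.continuous_const_rpow (T i).ratio_pos.ne'
  have h0 : (1 : ℝ) ≤ ∑ i, (T i).ratio ^ (0 : ℝ) := by
    simp only [Real.rpow_zero, Finset.sum_const, Finset.card_univ, Fintype.card_fin, nsmul_eq_mul,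
      mul_one]
    exact_mod_cast Fin.pos_iff_nonempty.2 ‹_›
  have hlim : Tendsto (fun t : ℝ => ∑ i, (T i).ratio ^ t) atTop (𝓝 0) := by
    rw [← Finset.sum_const_zero (s := (Finset.univ : Finset (Fin s)))]
    refine tendsto_finsetSum _ fun i _ => ?_
    have hpos := (T i).ratio_pos
    exact tendsto_rpow_atTop_of_base_lt_one _ (by linarith) (T i).ratio_lt_one
  obtain ⟨t, ht, ht0⟩ := ((hlim.eventually (gt_mem_nhds one_pos)).and
    (eventually_ge_atTop (0 : ℝ))).exists
  obtain ⟨D, hD, hD1⟩ := intermediate_value_Icc' ht0 hcont.continuousOn ⟨ht.le, h0⟩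
  exact ⟨D, hD.1, hD1⟩

/-- A self-similar set of dimension `α` carries a self-similar measure with weights
`(T i).ratio ^ α`. -/
theorem IsSelfSimilarOSC.exists_decomposition {α : ℝ} (hα₀ : 0 < α) {J : Set Plane}
    (hJ : IsSelfSimilarOSC J) (hdim : dimH J = ENNReal.ofReal α) :
    ∃ (s : ℕ) (T : Fin s → Similitude) (O : Set Plane) (ν : Measure Plane),
      IsOpen O ∧ O.Nonempty ∧ IsProbabilityMeasure ν ∧ ν Jᶜ = 0 ∧
      IsDecomposition α J O ν ν.real J O T := by
  obtain ⟨hc, hne, s, T, hJT, O, hO, hOne, hmaps, hdisj⟩ := hJ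
  have hs : Nonempty (Fin s) := by
    obtain ⟨x, hx⟩ := hne
    rw [hJT, mem_iUnion] at hx
    exact ⟨hx.choose⟩
  have hTJ : ∀ i, ∀ x ∈ J, (T i).map x ∈ J := by
    intro i x hx
    rw [hJT]
    exact mem_iUnion.2 ⟨i, mem_image_of_mem _ hx⟩
  obtain ⟨D, hD, hsum⟩ := exists_sum_ratio_rpow_eq_one T
  obtain ⟨ν, hprob, hν, hmass⟩ := exists_selfSimilar_measure hc hne hTJ
    (fun i => (T i).ratio ^ D) (fun i => Real.rpow_nonneg (T i).ratio_pos.le _) hsum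
  have hdec : IsDecomposition D J O ν ν.real J O T :=
    ⟨hmass, hJT, fun j => (subset_iUnion (fun i => (T i).map '' O) j).trans hmaps, hdisj⟩
  obtain ⟨c, C, hreg⟩ := hdec.exists_isRegularMeasure hD hν hc.isBounded hO hOne
  -- The similarity dimension is identified with α by the two bounds on the Hausdorff dimension.
  have hDα : D = α := by
    have h1 := hreg.le_dimH hD
    have h2 := hdec.dimH_le hD hc.isBounded
    rw [hdim] at h1 h2
    exact le_antisymm ((ENNReal.ofReal_le_ofReal_iff hα₀.le).1 h1)
      ((ENNReal.ofReal_le_ofReal_iff hD).1 h2)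
  subst hDα
  exact ⟨s, T, O, ν, hO, hOne, hprob, hν, hdec⟩

end

/-! ### Strips carry little self-similar mass -/

/-- Take three non-collinear points of J. If a thin strip contained them, its normal would be almost
orthogonal to two independent difference vectors; Cramer's rule then makes both coordinates of the
unit normal small. -/
theorem exists_not_subset_strip {J : Set Plane} (hne : J.Nonempty)
    (hline : ∀ ℓ : Set Plane, IsLine ℓ → ¬ J ⊆ ℓ) :
    ∃ h₀ : ℝ, 0 < h₀ ∧ ∀ (n : Plane) (t : ℝ), ‖n‖ = 1 → ¬ J ⊆ strip n t h₀ := by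
  obtain ⟨a, ha⟩ := hne
  have he : (!₂[1, 0] : Plane) ≠ 0 := fun h => by
    have := congrArg (fun v : Plane => v 0) h
    simp at this
  obtain ⟨b, hb, hab⟩ := not_subset.1 (hline _ ⟨a, _, he, rfl⟩)
  have hu : b - a ≠ 0 := fun h => hab ⟨0, by rw [zero_smul, add_zero, sub_eq_zero.1 h]⟩
  obtain ⟨c, hc, hac⟩ := not_subset.1 (hline _ ⟨a, b - a, hu, rfl⟩)
  set u := b - a
  set w := c - a with hw
  set d := u 0 * w 1 - u 1 * w 0 with hd
  have hd0 : d ≠ 0 := by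
    intro hd0
    rw [hd0] at hd
    have hcoord : ∃ i, u i ≠ 0 := by
      by_contra! h
      exact hu (by ext i; simpa using h i)
    obtain ⟨i, hi⟩ := hcoord
    refine hac ⟨w i / u i, ?_⟩
    have hwu : w = (w i / u i) • u := by
      ext k
      simp only [PiLp.smul_apply, smul_eq_mul]
      rw [div_mul_eq_mul_div, eq_div_iff hi]
      fin_cases i <;> fin_cases k <;> simp <;> linarith
    rw [← hwu, hw, add_sub_cancel]
  set M := |u 0| + |u 1| + |w 0| + |w 1|
  have hM : 0 ≤ M := by positivity
  have hd' : 0 < |d| := abs_pos.2 hd0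
  refine ⟨|d| / (8 * (M + 1)), by positivity, fun n t hn hsub => ?_⟩
  set h := |d| / (8 * (M + 1)) with hh
  have hdiff : ∀ x ∈ J, |inner ℝ n (x - a)| ≤ 2 * h := by
    intro x hx
    have h1 : |inner ℝ n x - t| ≤ h := hsub hx
    have h2 : |inner ℝ n a - t| ≤ h := hsub ha
    rw [inner_sub_right]
    rw [abs_le] at *
    constructor <;> linarith
  have hin : ∀ v : Plane, inner ℝ n v = n 0 * v 0 + n 1 * v 1 := fun v => by
    simp [PiLp.inner_apply, Fin.sum_univ_two, mul_comm]
  have h1 := hdiff b hb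
  have h2 := hdiff c hc
  change |inner ℝ n u| ≤ 2 * h at h1
  change |inner ℝ n w| ≤ 2 * h at h2
  have hh0 : 0 ≤ 2 * h := (abs_nonneg _).trans h1
  have e0 : |d| * |n 0| ≤ 2 * h * M := by
    rw [← abs_mul, show d * n 0 = w 1 * inner ℝ n u - u 1 * inner ℝ n w by rw [hin, hin]; ring]
    refine (abs_sub _ _).trans ?_
    rw [abs_mul, abs_mul]
    have := mul_le_mul_of_nonneg_left h1 (abs_nonneg (w 1))
    have := mul_le_mul_of_nonneg_left h2 (abs_nonneg (u 1))
    have := mul_nonneg hh0 (abs_nonneg (u 0))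
    have := mul_nonneg hh0 (abs_nonneg (w 0))
    simp only [M]
    linarith
  have e1 : |d| * |n 1| ≤ 2 * h * M := by
    rw [← abs_mul, show d * n 1 = u 0 * inner ℝ n w - w 0 * inner ℝ n u by rw [hin, hin]; ring]
    refine (abs_sub _ _).trans ?_
    rw [abs_mul, abs_mul]
    have := mul_le_mul_of_nonneg_left h1 (abs_nonneg (w 0))
    have := mul_le_mul_of_nonneg_left h2 (abs_nonneg (u 0))
    have := mul_nonneg hh0 (abs_nonneg (u 1))
    have := mul_nonneg hh0 (abs_nonneg (w 1))
    simp only [M]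
    linarith
  have hn1 : 1 ≤ |n 0| + |n 1| := by
    have h3 : n 0 ^ 2 + n 1 ^ 2 = 1 := by
      have := EuclideanSpace.real_norm_sq_eq n
      rw [hn, Fin.sum_univ_two] at this
      linarith
    nlinarith [sq_abs (n 0), sq_abs (n 1), abs_nonneg (n 0), abs_nonneg (n 1)]
  have h4 : |d| ≤ 4 * h * M := by nlinarith
  have h5 : 4 * h * (M + 1) = |d| / 2 := by
    rw [hh]; field_simp; norm_num
  nlinarith

section

variable {D : ℝ} {J O : Set Plane} {ν : Measure Plane}

theorem exists_rpow_ge {lam q : ℝ} (hlam : 0 < lam) (hq : 0 < q) :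
    ∃ κ : ℝ, 0 < κ ∧ κ ≤ 1 / 2 ∧ 1 - q ≤ lam ^ κ := by
  have h1 : Tendsto (fun κ : ℝ => lam ^ κ) (𝓝[>] 0) (𝓝 (lam ^ (0 : ℝ))) :=
    (Real.continuous_const_rpow hlam.ne').continuousAt.tendsto.mono_left nhdsWithin_le_nhds
  rw [Real.rpow_zero] at h1
  obtain ⟨κ, hκ, hκ0, hκ1⟩ := ((h1.eventually (lt_mem_nhds (by linarith : 1 - q < 1))).and
    (Ioc_mem_nhdsGT (by norm_num : (0 : ℝ) < 1 / 2))).exists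
  exact ⟨κ, hκ0, hκ1, hκ.le⟩

/-- At one fixed scale some piece misses the strip, so at least the fraction `lam ^ D` of the mass
drops out; the remaining pieces see wider strips with other normals, to which induction applies. -/
theorem IsDecomposition.exists_strip_bound [IsProbabilityMeasure ν] {s : ℕ}
    {T : Fin s → Similitude} (hT : IsDecomposition D J O ν ν.real J O T) (hD : 0 ≤ D)
    (hν : ν Jᶜ = 0) (hJ : Bornology.IsBounded J) (hne : J.Nonempty)
    (hline : ∀ ℓ : Set Plane, IsLine ℓ → ¬ J ⊆ ℓ) :
    ∃ κ B : ℝ, 0 < κ ∧ κ ≤ 1 / 2 ∧ 0 < B ∧ ∀ (n : Plane) (t η : ℝ), ‖n‖ = 1 → 0 < η →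
      ν.real (strip n t η) ≤ B * η ^ κ := by
  classical
  obtain ⟨h₀, hh₀, hns⟩ := exists_not_subset_strip hne hline
  obtain ⟨lam', hlam'₀, hlam'₁, hlam'⟩ := exists_le_ratio T
  have hd := diam_nonneg (s := J)
  -- Pieces have diameter at most h₀ / 2, so one that meets the half-width h₀ / 2 lies in the
  -- half-width h₀. The piece through a point outside the larger strip misses the smaller one.
  obtain ⟨r, hr₀, hr₁, hrd⟩ : ∃ r : ℝ, 0 < r ∧ r < 1 ∧ r * diam J ≤ h₀ / 2 := by
    refine ⟨min (1 / 2) (h₀ / (2 * (diam J + 1))), by positivity,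
      (min_le_left _ _).trans_lt (by norm_num), ?_⟩
    calc min (1 / 2) (h₀ / (2 * (diam J + 1))) * diam J
        ≤ h₀ / (2 * (diam J + 1)) * (diam J + 1) := by
          gcongr
          · exact min_le_right _ _
          · linarith
      _ = h₀ / 2 := by field_simp
  obtain ⟨ι, _, S, hS, hSr⟩ := hT.exists_scale hlam'₀ hlam' hr₀ hr₁
  set lam := lam' * r
  have hlam₀ : 0 < lam := by positivity
  have hlam₁ : lam < 1 := mul_lt_one_of_nonneg_of_lt_one_left hlam'₀.le hlam'₁ hr₁.le
  -- The exponent turns the factor 1 - lam ^ D lost per step into lam ^ κ.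
  obtain ⟨κ, hκ₀, hκ₁, hκ⟩ := exists_rpow_ge hlam₀ (q := lam ^ D) (by positivity)
  set η₀ := h₀ / 2
  have hη₀ : 0 < η₀ := by positivity
  have hmiss : ∀ (n : Plane) (t : ℝ), ‖n‖ = 1 →
      ∃ j, ∀ y ∈ J, (S j).map y ∉ strip n t η₀ := by
    intro n t hn
    obtain ⟨x, hx, hxs⟩ := not_subset.1 (hns n t hn)
    have hx' := hx
    rw [hS.cover, mem_iUnion] at hx'
    obtain ⟨j, z, hz, rfl⟩ := hx'
    refine ⟨j, fun y hy hys => hxs ?_⟩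
    have h1 : dist ((S j).map z) ((S j).map y) ≤ η₀ := by
      rw [Similitude.dist_map]
      exact (mul_le_mul (hSr j).2 (dist_le_diam_of_mem hJ hz hy) dist_nonneg hr₀.le).trans hrd
    have h2 := mem_strip_of_dist_le hn hys h1
    rwa [show η₀ + η₀ = h₀ by simp only [η₀]; ring] at h2
  have hdecay : ∀ (k : ℕ) (n : Plane) (t : ℝ), ‖n‖ = 1 →
      ν.real (strip n t (η₀ * lam ^ k)) ≤ (lam ^ κ) ^ k := by
    intro k
    induction k with
    | zero => intro n t _; rw [pow_zero, pow_zero]; exact measureReal_le_one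
    | succ k ih =>
      intro n t hn
      obtain ⟨j₀, hj₀⟩ := hmiss n t hn
      have hle : η₀ * lam ^ (k + 1) ≤ η₀ :=
        mul_le_of_le_one_right hη₀.le (pow_le_one₀ hlam₀.le hlam₁.le)
      have hzero := measureReal_preimage_eq_zero hν (S j₀) (E := strip n t (η₀ * lam ^ (k + 1)))
        (fun y hy hys => hj₀ y hy (strip_mono n t hle hys))
      have hpiece : ∀ j, ν.real ((S j).map ⁻¹' strip n t (η₀ * lam ^ (k + 1))) ≤
          (lam ^ κ) ^ k := by
        intro j
        obtain ⟨n', t', hn', heq⟩ := (S j).preimage_strip hn t (η₀ * lam ^ (k + 1))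
        rw [heq]
        refine le_trans (measureReal_mono (strip_mono n' t' ?_)) (ih n' t' hn')
        rw [div_le_iff₀ (S j).ratio_pos]
        calc η₀ * lam ^ (k + 1) = η₀ * lam ^ k * lam := by ring
          _ ≤ η₀ * lam ^ k * (S j).ratio := by gcongr; exact (hSr j).1
      have hpow : 0 ≤ (lam ^ κ) ^ k := by positivity
      rw [hS.mass _ (isClosed_strip _ _ _).measurableSet,
        ← Finset.add_sum_erase _ _ (Finset.mem_univ j₀), hzero, mul_zero, zero_add]
      calc ∑ j ∈ Finset.univ.erase j₀, (S j).ratio ^ D *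
              ν.real ((S j).map ⁻¹' strip n t (η₀ * lam ^ (k + 1)))
          ≤ ∑ j ∈ Finset.univ.erase j₀, (S j).ratio ^ D * (lam ^ κ) ^ k :=
            Finset.sum_le_sum fun j _ => mul_le_mul_of_nonneg_left (hpiece j)
              (Real.rpow_nonneg (S j).ratio_pos.le _)
        _ = (1 - (S j₀).ratio ^ D) * (lam ^ κ) ^ k := by
            rw [← Finset.sum_mul, ← hS.sum_ratio_rpow,
              ← Finset.add_sum_erase _ _ (Finset.mem_univ j₀)]
            ring
        _ ≤ lam ^ κ * (lam ^ κ) ^ k := by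
            refine mul_le_mul_of_nonneg_right (le_trans ?_ hκ) hpow
            have := Real.rpow_le_rpow hlam₀.le (hSr j₀).1 hD
            linarith
        _ = (lam ^ κ) ^ (k + 1) := by ring
  -- The factor 1 / lam absorbs rounding η / η₀ to a power of lam; for η > η₀ the bound is at least
  -- one.
  refine ⟨κ, (1 / (η₀ * lam)) ^ κ, hκ₀, hκ₁, by positivity, fun n t η hn hη => ?_⟩
  rw [← Real.mul_rpow (by positivity) hη.le]
  rcases le_or_gt η η₀ with h | h
  · obtain ⟨k, hk1, hk2⟩ := exists_nat_pow_near_of_lt_one (x := η / η₀) (by positivity)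
      ((div_le_one hη₀).2 h) hlam₀ hlam₁
    rw [lt_div_iff₀ hη₀] at hk1
    rw [div_le_iff₀ hη₀] at hk2
    calc ν.real (strip n t η) ≤ ν.real (strip n t (η₀ * lam ^ k)) :=
          measureReal_mono (strip_mono n t (by linarith))
      _ ≤ (lam ^ κ) ^ k := hdecay k n t hn
      _ = (lam ^ k) ^ κ := by
          rw [← Real.rpow_natCast, ← Real.rpow_natCast, ← Real.rpow_mul hlam₀.le,
            ← Real.rpow_mul hlam₀.le, mul_comm]
      _ ≤ (1 / (η₀ * lam) * η) ^ κ := by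
          refine Real.rpow_le_rpow (by positivity) ?_ hκ₀.le
          rw [one_div_mul_eq_div, le_div_iff₀ (by positivity)]
          calc lam ^ k * (η₀ * lam) = lam ^ (k + 1) * η₀ := by ring
            _ ≤ η := hk1.le
  · refine measureReal_le_one.trans (Real.one_le_rpow ?_ hκ₀.le)
    rw [one_div_mul_eq_div, one_le_div (by positivity)]
    exact (mul_le_of_le_one_right hη₀.le hlam₁.le).trans h.le

/-- The mass of the intersection of a strip with a ball. -/
theorem IsDecomposition.exists_slab_bound [IsProbabilityMeasure ν] {s : ℕ}
    {T : Fin s → Similitude} (hT : IsDecomposition D J O ν ν.real J O T)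
    (hν : ν Jᶜ = 0) (hJ : Bornology.IsBounded J) (hO : IsOpen O) (hOne : O.Nonempty)
    {κ B : ℝ} (hκ : 0 < κ) (hκD : κ ≤ D) (hB : 0 < B)
    (hstrip : ∀ (n : Plane) (t η : ℝ), ‖n‖ = 1 → 0 < η → ν.real (strip n t η) ≤ B * η ^ κ) :
    ∃ B' : ℝ, 0 < B' ∧ ∀ (n : Plane) (t : ℝ) (x : Plane) (h r : ℝ), ‖n‖ = 1 → 0 < h → h ≤ r →
      ν.real (strip n t h ∩ closedBall x r) ≤ B' * h ^ κ * r ^ (D - κ) := by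
  classical
  obtain ⟨lam, hlam₀, -, hlam⟩ := exists_le_ratio T
  obtain ⟨N, hN, hcard⟩ := IsDecomposition.exists_card_le (D := D) (ν := ν) hJ hO hOne hlam₀
  refine ⟨N * B / lam ^ κ + B, by positivity, fun n t x h r hn hh hhr => ?_⟩
  have hr : 0 < r := hh.trans_le hhr
  have hm : MeasurableSet (strip n t h ∩ closedBall x r) :=
    ((isClosed_strip n t h).inter isClosed_closedBall).measurableSet
  rcases lt_or_ge r 1 with h1 | h1
  -- At scale r at most N pieces meet the ball, and in each the strip pulls back to half-width at
  -- most h / (lam * r).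
  · obtain ⟨ι, _, S, hS, hSr⟩ := hT.exists_scale hlam₀ hlam hr h1
    set F : Finset ι := Finset.univ.filter fun j => ∃ y ∈ J, (S j).map y ∈ closedBall x r
    have hF := hcard _ _ _ ι _ S hS r hr hSr x F (fun j hj => (Finset.mem_filter.1 hj).2)
    have hpiece : ∀ j, ν.real ((S j).map ⁻¹' (strip n t h ∩ closedBall x r)) ≤
        B * (h / (lam * r)) ^ κ := by
      intro j
      have hj := (S j).ratio_pos
      obtain ⟨n', t', hn', heq⟩ := (S j).preimage_strip hn t h
      calc ν.real ((S j).map ⁻¹' (strip n t h ∩ closedBall x r))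
          ≤ ν.real (strip n' t' (h / (S j).ratio)) := by
            rw [← heq]; exact measureReal_mono (preimage_mono inter_subset_left)
        _ ≤ B * (h / (S j).ratio) ^ κ := hstrip n' t' _ hn' (by positivity)
        _ ≤ B * (h / (lam * r)) ^ κ := by gcongr; exact (hSr j).1
    rw [hS.mass _ hm]
    calc ∑ j, (S j).ratio ^ D * ν.real ((S j).map ⁻¹' (strip n t h ∩ closedBall x r))
        = ∑ j ∈ F, (S j).ratio ^ D * ν.real ((S j).map ⁻¹' (strip n t h ∩ closedBall x r)) := by
          refine (Finset.sum_subset (Finset.subset_univ F) fun j _ hj => ?_).symm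
          rw [measureReal_preimage_eq_zero hν, mul_zero]
          intro y hy hyE
          exact hj (Finset.mem_filter.2 ⟨Finset.mem_univ _, y, hy, hyE.2⟩)
      _ ≤ ∑ j ∈ F, r ^ D * (B * (h / (lam * r)) ^ κ) := by
          refine Finset.sum_le_sum fun j _ => mul_le_mul ?_ (hpiece j)
            measureReal_nonneg (by positivity)
          exact Real.rpow_le_rpow (S j).ratio_pos.le (hSr j).2 (hκ.le.trans hκD)
      _ = F.card * (r ^ D * (B * (h / (lam * r)) ^ κ)) := by simp
      _ ≤ N * (r ^ D * (B * (h / (lam * r)) ^ κ)) := by gcongr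
      _ = (N * B / lam ^ κ + 0) * h ^ κ * r ^ (D - κ) := by
          rw [Real.div_rpow hh.le (by positivity), Real.mul_rpow hlam₀.le hr.le,
            Real.rpow_sub hr]
          field_simp
          ring
      _ ≤ _ := by gcongr
  · calc ν.real (strip n t h ∩ closedBall x r) ≤ ν.real (strip n t h) :=
          measureReal_mono inter_subset_left
      _ ≤ B * h ^ κ * 1 := by rw [mul_one]; exact hstrip n t h hn hh
      _ ≤ B * h ^ κ * r ^ (D - κ) := by
          gcongr; exact Real.one_le_rpow h1 (by linarith)
      _ ≤ (N * B / lam ^ κ + B) * h ^ κ * r ^ (D - κ) := by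
          gcongr
          have : 0 < N * B / lam ^ κ := by positivity
          linarith

end

/-! ### Images under diffeomorphisms -/

section

variable {D α c C : ℝ} {J O : Set Plane} {ν : Measure Plane} {f g : Plane → Plane}

theorem measureReal_le_of_inter_subset [IsFiniteMeasure ν] (hν : ν Jᶜ = 0) {E F : Set Plane}
    (h : ∀ x ∈ J, x ∈ E → x ∈ F) : ν.real E ≤ ν.real F := by
  have h1 : ν E ≤ ν F := by
    calc ν E ≤ ν (F ∪ Jᶜ) := by
          refine measure_mono fun x hx => ?_
          by_cases hxJ : x ∈ J
          exacts [Or.inl (h x hxJ hx), Or.inr hxJ]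
      _ ≤ ν F + ν Jᶜ := measure_union_le _ _
      _ = ν F := by rw [hν, add_zero]
  exact ENNReal.toReal_mono (measure_ne_top _ _) h1

theorem exists_strip_le {κ B : ℝ} (hκ : 0 < κ) (hB : 0 < B)
    (hstrip : ∀ (n : Plane) (t η : ℝ), ‖n‖ = 1 → 0 < η → ν.real (strip n t η) ≤ B * η ^ κ)
    (ε : ℝ) (hε : 0 < ε) : ∃ η : ℝ, 0 < η ∧
      ∀ (n : Plane) (t : ℝ), ‖n‖ = 1 → ν.real (strip n t η) ≤ ε := by
  refine ⟨(ε / B) ^ κ⁻¹, by positivity, fun n t hn => ?_⟩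
  refine (hstrip n t _ hn (by positivity)).trans_eq ?_
  rw [Real.rpow_inv_rpow (by positivity) hκ.ne']
  field_simp

/-- A `C¹` map is close to affine at small scales, so the preimage of a thin strip is locally
contained in a thin strip. -/
theorem mem_strip_of_mem_preimage_strip {A : Plane →L[ℝ] Plane} {y₀ n v : Plane} {t h e L : ℝ}
    (hn : ‖n‖ = 1) (hv : A v = n) (hvL : ‖v‖ ≤ L) :
    ∃ (n' : Plane) (t' : ℝ), ‖n'‖ = 1 ∧ ∀ y, ‖f y - f y₀ - A (y - y₀)‖ ≤ e →
      f y ∈ strip n t h → y ∈ strip n' t' (L * (h + e)) := by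
  -- Up to normalisation, m is the normal of the pulled-back strip; its pairing with v equals 1,
  -- which keeps its length at least 1 / L.
  set m := ContinuousLinearMap.adjoint A n
  have hm : ∀ z, inner ℝ m z = inner ℝ n (A z) := fun z =>
    ContinuousLinearMap.adjoint_inner_left A z n
  have h1 : 1 ≤ ‖m‖ * L := by
    calc (1 : ℝ) = inner ℝ m v := by rw [hm, hv, real_inner_self_eq_norm_sq, hn, one_pow]
      _ ≤ ‖m‖ * ‖v‖ := real_inner_le_norm m v
      _ ≤ ‖m‖ * L := by gcongr
  have hm0 : 0 < ‖m‖ := by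
    rcases (norm_nonneg m).eq_or_lt with h0 | h0
    · rw [← h0, zero_mul] at h1; linarith
    · exact h0
  have hmL : ‖m‖⁻¹ ≤ L := by rwa [inv_le_iff_one_le_mul₀' hm0]
  refine ⟨‖m‖⁻¹ • m, ‖m‖⁻¹ * (inner ℝ m y₀ + (t - inner ℝ n (f y₀))), ?_, fun y hy hys => ?_⟩
  · rw [norm_smul, norm_inv, norm_norm, inv_mul_cancel₀ hm0.ne']
  · have h2 : |inner ℝ n (f y) - t| ≤ h := hys
    have h3 : |inner ℝ n (f y - f y₀ - A (y - y₀))| ≤ e := by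
      refine (abs_real_inner_le_norm _ _).trans ?_
      rwa [hn, one_mul]
    have h4 : inner ℝ (‖m‖⁻¹ • m) y - ‖m‖⁻¹ * (inner ℝ m y₀ + (t - inner ℝ n (f y₀))) =
        ‖m‖⁻¹ * ((inner ℝ n (f y) - t) - inner ℝ n (f y - f y₀ - A (y - y₀))) := by
      rw [inner_sub_right, inner_sub_right, ← hm, inner_sub_right, real_inner_smul_left]
      ring
    rw [strip, mem_ofPred_eq, h4, abs_mul, abs_of_pos (inv_pos.2 hm0)]
    exact mul_le_mul hmL ((abs_sub _ _).trans (add_le_add h2 h3)) (abs_nonneg _)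
      ((inv_pos.2 hm0).le.trans hmL)

/-- On each piece of a small fixed scale r the map is affine up to a small multiple of r. Rescaled
to J, the preimage of the strip lies, on J, in a strip of half-width w and mass at most ε; averaging
over the pieces keeps ε. -/
theorem IsDecomposition.exists_preimage_strip_le [IsProbabilityMeasure ν] {s : ℕ}
    {T : Fin s → Similitude} (hT : IsDecomposition D J O ν ν.real J O T)
    (hν : ν Jᶜ = 0) (hJ : IsCompact J) (hne : J.Nonempty)
    (hstrip : ∀ ε : ℝ, 0 < ε → ∃ η : ℝ, 0 < η ∧
      ∀ (n : Plane) (t : ℝ), ‖n‖ = 1 → ν.real (strip n t η) ≤ ε)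
    (hf : ContDiff ℝ 1 f) (hg : ContDiff ℝ 1 g) (hfg : ∀ x, f (g x) = x) (hgf : ∀ x, g (f x) = x)
    (ε : ℝ) (hε : 0 < ε) : ∃ η : ℝ, 0 < η ∧
      ∀ (n : Plane) (t : ℝ), ‖n‖ = 1 → ν.real (f ⁻¹' strip n t η) ≤ ε := by
  obtain ⟨lam, hlam₀, -, hlam⟩ := exists_le_ratio T
  obtain ⟨R, hR, hJR⟩ := hJ.isBounded.subset_closedBall_lt 0 0
  have hd := diam_nonneg (s := J)
  obtain ⟨w, hw, hws⟩ := hstrip ε hε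
  have hDf : Continuous (fderiv ℝ f) := hf.continuous_fderiv one_ne_zero
  have hDg : Continuous (fderiv ℝ g) := hg.continuous_fderiv one_ne_zero
  obtain ⟨L, hL, hgL⟩ : ∃ L : ℝ, 0 < L ∧ ∀ y ∈ J, ‖fderiv ℝ g (f y)‖ ≤ L := by
    obtain ⟨L, hL⟩ := hJ.exists_bound_of_continuousOn (hDg.comp hf.continuous).continuousOn
    exact ⟨max L 1, by positivity, fun y hy => (hL y hy).trans (le_max_left _ _)⟩
  set d := diam J + 1
  have hd₀ : 0 < d := by positivity
  -- The linearisation error uses half of the budget w, and the half-width of the strip the other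
  -- half.
  set e := lam * w / (2 * L * d)
  have he : 0 < e := by positivity
  -- The ball replaces J because the mean value inequality needs a convex domain.
  have huc := (isCompact_closedBall (0 : Plane) R).uniformContinuousOn_of_continuous
    hDf.continuousOn
  rw [Metric.uniformContinuousOn_iff_le] at huc
  obtain ⟨ρ, hρ, hρe⟩ := huc e he
  obtain ⟨r, hr₀, hr₁, hrd⟩ : ∃ r : ℝ, 0 < r ∧ r < 1 ∧ r * d ≤ ρ := by
    refine ⟨min (1 / 2) (ρ / d), by positivity, (min_le_left _ _).trans_lt (by norm_num), ?_⟩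
    rw [← le_div_iff₀ hd₀]
    exact min_le_right _ _
  obtain ⟨ι, _, S, hS, hSr⟩ := hT.exists_scale hlam₀ hlam hr₀ hr₁
  refine ⟨lam * r * w / (2 * L), by positivity, fun n t hn => ?_⟩
  set h := lam * r * w / (2 * L) with hh
  have hm : MeasurableSet (f ⁻¹' strip n t h) :=
    ((isClosed_strip n t h).preimage hf.continuous).measurableSet
  have hpiece : ∀ j, ν.real ((S j).map ⁻¹' (f ⁻¹' strip n t h)) ≤ ε := by
    intro j
    have hj := (S j).ratio_pos
    obtain ⟨x₀, hx₀⟩ := hne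
    have hy₀J := hS.mem_of_mem j hx₀
    set y₀ := (S j).map x₀
    have hcomp : fderiv ℝ f y₀ (fderiv ℝ g (f y₀) n) = n := by
      have h1 : HasFDerivAt g (fderiv ℝ g (f y₀)) (f y₀) :=
        (hg.differentiable one_ne_zero _).hasFDerivAt
      have h2 : HasFDerivAt f (fderiv ℝ f y₀) (g (f y₀)) := by
        rw [hgf]; exact (hf.differentiable one_ne_zero _).hasFDerivAt
      have h3 := h2.comp _ h1
      have h4 : HasFDerivAt (f ∘ g) (ContinuousLinearMap.id ℝ Plane) (f y₀) := by
        rw [show f ∘ g = id from funext hfg]; exact hasFDerivAt_id _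
      exact congrArg (fun A : Plane →L[ℝ] Plane => A n) (h3.unique h4)
    have hvL : ‖fderiv ℝ g (f y₀) n‖ ≤ L := by
      refine (ContinuousLinearMap.le_opNorm _ _).trans ?_
      rw [hn, mul_one]
      exact hgL y₀ hy₀J
    obtain ⟨n₁, t₁, hn₁, h₁⟩ := mem_strip_of_mem_preimage_strip (f := f) (y₀ := y₀) (t := t)
      (h := h) (e := e * (r * d)) hn hcomp hvL
    obtain ⟨n₂, t₂, hn₂, h₂⟩ := (S j).preimage_strip hn₁ t₁ (L * (h + e * (r * d)))
    refine le_trans (measureReal_le_of_inter_subset hν fun x hx hxs => ?_) (hws n₂ t₂ hn₂)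
    have hyJ := hS.mem_of_mem j hx
    have hdist : ‖(S j).map x - y₀‖ ≤ r * d := by
      rw [← dist_eq_norm, Similitude.dist_map]
      exact mul_le_mul (hSr j).2
        ((dist_le_diam_of_mem hJ.isBounded hx hx₀).trans (by simp only [d]; linarith))
        dist_nonneg hr₀.le
    have herr : ‖f ((S j).map x) - f y₀ - fderiv ℝ f y₀ ((S j).map x - y₀)‖ ≤ e * (r * d) := by
      refine le_trans (Convex.norm_image_sub_le_of_norm_fderiv_le' (𝕜 := ℝ)
        (s := closedBall 0 R ∩ closedBall y₀ ρ) (C := e)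
        (fun z _ => hf.differentiable one_ne_zero z) (fun z hz => ?_)
        ((convex_closedBall _ _).inter (convex_closedBall _ _))
        ⟨hJR hy₀J, mem_closedBall_self hρ.le⟩ ⟨hJR hyJ, ?_⟩) ?_
      · rw [← dist_eq_norm]
        exact hρe z hz.1 y₀ (hJR hy₀J) hz.2
      · rw [mem_closedBall, dist_eq_norm]; exact hdist.trans hrd
      · gcongr
    have hmem : x ∈ (S j).map ⁻¹' strip n₁ t₁ (L * (h + e * (r * d))) := h₁ _ herr hxs
    rw [h₂] at hmem
    refine strip_mono n₂ t₂ ?_ hmem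
    rw [div_le_iff₀ hj]
    calc L * (h + e * (r * d)) = w * (lam * r) := by
          simp only [hh, e]; field_simp; norm_num
      _ ≤ w * (S j).ratio := by gcongr; exact (hSr j).1
  rw [hS.mass _ hm]
  calc ∑ j, (S j).ratio ^ D * ν.real ((S j).map ⁻¹' (f ⁻¹' strip n t h))
      ≤ ∑ j, (S j).ratio ^ D * ε := Finset.sum_le_sum fun j _ =>
        mul_le_mul_of_nonneg_left (hpiece j) (Real.rpow_nonneg (S j).ratio_pos.le _)
    _ = ε := by rw [← Finset.sum_mul, hS.sum_ratio_rpow, one_mul]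

theorem exists_dist_le_mul (hf : ContDiff ℝ 1 f) (R : ℝ) :
    ∃ L : ℝ, 1 ≤ L ∧ ∀ x ∈ closedBall (0 : Plane) R, ∀ y ∈ closedBall (0 : Plane) R,
      dist (f x) (f y) ≤ L * dist x y := by
  obtain ⟨L, hL⟩ := (hf.locallyLipschitz.locallyLipschitzOn
    (s := closedBall (0 : Plane) R)).exists_lipschitzOnWith_of_compact (isCompact_closedBall 0 R)
  refine ⟨max L 1, le_max_right _ _, fun x hx y hy => (hL.dist_le_mul x hx y hy).trans ?_⟩
  gcongr
  exact le_max_left _ _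

/-- The Lipschitz bound for f gives the lower mass bound, and that for its inverse on the image
gives the upper one. The factor 2 comes from recentring a ball at a point of the image. -/
theorem IsRegularMeasure.map (hν : IsRegularMeasure α c C J ν) (hf : Continuous f)
    (hinj : Function.Injective f) (hJ : IsCompact J) {L : ℝ} (hL : 0 < L)
    (hfL : ∀ x ∈ J, ∀ y, dist y x ≤ 1 → dist (f y) (f x) ≤ L * dist y x) (hL₁ : 1 ≤ L)
    (hgL : ∀ x ∈ J, ∀ y ∈ J, dist x y ≤ L * dist (f x) (f y)) :
    IsRegularMeasure α (c / L ^ α) (C * (2 * L) ^ α) (f '' J) (ν.map f) := by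
  have := hν.prob
  have hc := hν.lower_pos
  have hC := hν.upper_pos
  have hball : ∀ (x : Plane) (r : ℝ),
      (ν.map f).real (closedBall x r) = ν.real (f ⁻¹' closedBall x r) := fun x r => by
    rw [Measure.real, Measure.map_apply hf.measurable measurableSet_closedBall]; rfl
  refine ⟨Measure.isProbabilityMeasure_map hf.aemeasurable, ?_, by positivity, by positivity,
    ?_, ?_⟩
  · rw [Measure.map_apply hf.measurable (hJ.image hf).isClosed.measurableSet.compl,
      preimage_compl, preimage_image_eq J hinj, hν.compl]
  · intro x r hr
    rw [hball, mul_assoc, ← Real.mul_rpow (by positivity) hr.le]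
    by_cases hne : ∃ y ∈ J, f y ∈ closedBall x r
    · obtain ⟨y, hy, hyx⟩ := hne
      refine le_trans (measureReal_le_of_inter_subset hν.compl fun z hz hzx => ?_)
        (hν.upper y (2 * L * r) (by positivity))
      rw [mem_preimage, mem_closedBall] at hzx
      rw [mem_closedBall] at hyx ⊢
      refine (hgL z hz y hy).trans ?_
      have h1 := dist_triangle_right (f z) (f y) x
      calc L * dist (f z) (f y) ≤ L * (2 * r) := by gcongr; linarith
        _ = 2 * L * r := by ring
    · push Not at hne
      have h0 : ν.real (f ⁻¹' closedBall x r) ≤ ν.real ∅ :=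
        measureReal_le_of_inter_subset hν.compl fun z hz hzx => absurd hzx (hne z hz)
      rw [measureReal_empty] at h0
      exact h0.trans (by positivity)
  · rintro _ ⟨x, hx, rfl⟩ r hr hr1
    rw [hball, div_mul_eq_mul_div, mul_div_assoc, ← Real.div_rpow hr.le hL.le]
    have hrL : r / L ≤ 1 := by rw [div_le_one hL]; linarith
    refine (hν.lower x hx (r / L) (by positivity) hrL).trans (measureReal_mono fun y hy => ?_)
    rw [mem_closedBall] at hy
    rw [mem_preimage, mem_closedBall]
    refine (hfL x hx y (hy.trans hrL)).trans ?_
    rwa [le_div_iff₀' hL] at hy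

/-! ### Sandwiching neighbourhoods between unions of balls -/

/-- The δ-balls around a δ-net lie in the neighbourhood, and doubling their radius covers it. -/
theorem isEquivalentTo_of_net {Q : ℝ → ℝ → Set Plane → Prop} {C₀ : ℝ} (hC₀ : 0 < C₀)
    (hJ : IsCompact J)
    (hQ : ∀ δ : ℝ, 0 < δ → δ ≤ 1 → ∀ P : Finset Plane, IsNet J δ P →
      ∀ ρ : ℝ, δ ≤ ρ → ρ ≤ 2 * δ → Q C₀ ρ (ballUnion P ρ)) {δ : ℝ} (hδ : 0 < δ) (hδ₁ : δ ≤ 1) :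
    IsEquivalentTo Q 2 C₀ δ (nbhd J δ) := by
  obtain ⟨P, hP⟩ := exists_isNet hJ.isBounded hδ
  refine ⟨C₀, C₀, δ, 2 * δ, ballUnion P δ, ballUnion P (2 * δ), ⟨by linarith, by linarith⟩,
    ⟨by linarith, by linarith⟩, ⟨by linarith, by linarith⟩, ⟨by linarith, by linarith⟩,
    hQ δ hδ hδ₁ P hP δ le_rfl (by linarith), hQ δ hδ hδ₁ P hP (2 * δ) (by linarith) le_rfl,
    iUnion₂_subset fun p hp => subset_biUnion_of_mem (u := fun x => closedBall x δ)
      (hP.subset p hp), iUnion₂_subset fun x hx => ?_⟩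
  obtain ⟨p, hp, hxp⟩ := hP.cover x hx
  exact (closedBall_subset_closedBall' (by linarith)).trans
    (subset_biUnion_of_mem (u := fun x => closedBall x (2 * δ)) hp)

/-- With a net of the image at scale δ / L, the inner balls pull back into δ-balls. Outside, the
image of a δ-ball has radius at most L * δ and its centre is δ / L from the net, in total (L ^ 2 +
1) * (δ / L). -/
theorem isEquivalentTo_image_of_net {Q : ℝ → ℝ → Set Plane → Prop} {C₀ L : ℝ} (hC₀ : 0 < C₀)
    (hL : 1 ≤ L) (hJ : IsCompact J) (hf : Continuous f) (hfg : ∀ x, f (g x) = x)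
    (hfL : ∀ x ∈ J, ∀ y, dist y x ≤ 1 → dist (f y) (f x) ≤ L * dist y x)
    (hgL : ∀ x ∈ J, ∀ y, dist y (f x) ≤ 1 → dist (g y) x ≤ L * dist y (f x))
    (hQ : ∀ δ : ℝ, 0 < δ → δ ≤ 1 → ∀ P : Finset Plane, IsNet (f '' J) δ P →
      ∀ ρ : ℝ, δ ≤ ρ → ρ ≤ (L ^ 2 + 1) * δ → Q C₀ ρ (ballUnion P ρ))
    {δ : ℝ} (hδ : 0 < δ) (hδ₁ : δ ≤ 1) :
    IsEquivalentTo Q (L ^ 2 + 1) C₀ δ (f '' nbhd J δ) := by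
  have hL₀ : 0 < L := by linarith
  have hδL : 0 < δ / L := by positivity
  have hδL₁ : δ / L ≤ 1 := by rw [div_le_one hL₀]; linarith
  have hLδ : L * (δ / L) = δ := by field_simp
  have hL2 : L ≤ L ^ 2 := le_self_pow₀ hL two_ne_zero
  obtain ⟨P, hP⟩ := exists_isNet (hJ.image hf).isBounded hδL
  have hle : δ / L ≤ δ := div_le_self hδ.le hL
  have hK : δ ≤ (L ^ 2 + 1) * (δ / L) := by
    calc δ = L * (δ / L) := hLδ.symm
      _ ≤ (L ^ 2 + 1) * (δ / L) := by gcongr; linarith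
  have hK1 : 1 ≤ L ^ 2 + 1 := by nlinarith
  refine ⟨C₀, C₀, δ / L, (L ^ 2 + 1) * (δ / L), ballUnion P (δ / L),
    ballUnion P ((L ^ 2 + 1) * (δ / L)), ⟨?_, ?_⟩, ⟨?_, ?_⟩, ⟨?_, hK⟩, ⟨?_, ?_⟩,
    hQ _ hδL hδL₁ P hP _ le_rfl ?_, hQ _ hδL hδL₁ P hP _ ?_ le_rfl, ?_, ?_⟩
  · exact le_mul_of_one_le_left hC₀.le hK1
  · exact le_mul_of_one_le_left hC₀.le hK1
  · exact le_mul_of_one_le_left hC₀.le hK1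
  · exact le_mul_of_one_le_left hC₀.le hK1
  · exact hle.trans (le_mul_of_one_le_left hδ.le hK1)
  · gcongr
  · exact hK.trans (le_mul_of_one_le_left (by positivity) hK1)
  · exact le_mul_of_one_le_left hδL.le hK1
  · exact le_mul_of_one_le_left hδL.le hK1
  · refine iUnion₂_subset fun p hp y hy => ⟨g y, ?_, hfg y⟩
    obtain ⟨x, hx, rfl⟩ := hP.subset p hp
    rw [mem_closedBall] at hy
    refine mem_biUnion hx ?_
    rw [mem_closedBall]
    refine (hgL x hx y (hy.trans hδL₁)).trans ?_
    rw [← hLδ]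
    gcongr
  · rintro _ ⟨z, hz, rfl⟩
    simp only [nbhd, mem_iUnion] at hz
    obtain ⟨x, hx, hzx⟩ := hz
    rw [mem_closedBall] at hzx
    obtain ⟨p, hp, hxp⟩ := hP.cover (f x) (mem_image_of_mem f hx)
    refine mem_biUnion hp ?_
    rw [mem_closedBall]
    calc dist (f z) p ≤ dist (f z) (f x) + dist (f x) p := dist_triangle _ _ _
      _ ≤ L * (L * (δ / L)) + δ / L := by
          rw [hLδ]
          exact add_le_add ((hfL x hx z (hzx.trans hδ₁)).trans (by gcongr)) hxp
      _ = (L ^ 2 + 1) * (δ / L) := by ring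

/-- The image of a self-similar set under a `C¹` diffeomorphism. -/
theorem IsDecomposition.exists_isEquivalentTo_image [IsProbabilityMeasure ν] {s : ℕ}
    {T : Fin s → Similitude} (hT : IsDecomposition α J O ν ν.real J O T) (hα₀ : 0 < α)
    (hα₁ : α ≤ 1) (hν : IsRegularMeasure α c C J ν) (hJ : IsCompact J) (hne : J.Nonempty)
    (hstrip : ∀ ε : ℝ, 0 < ε → ∃ η : ℝ, 0 < η ∧
      ∀ (n : Plane) (t : ℝ), ‖n‖ = 1 → ν.real (strip n t η) ≤ ε)
    (hf : ContDiff ℝ 1 f) (hg : ContDiff ℝ 1 g) (hfg : ∀ x, f (g x) = x)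
    (hgf : ∀ x, g (f x) = x) :
    ∃ C₀ K : ℝ, 0 < C₀ ∧ 1 ≤ K ∧ ∀ δ : ℝ, 0 < δ → δ ≤ 1 →
      IsEquivalentTo (IsUnconcentrated α) K C₀ δ (f '' nbhd J δ) := by
  obtain ⟨R, hR, hJR⟩ := hJ.isBounded.subset_closedBall_lt 0 0
  obtain ⟨R', hR', hJR'⟩ := (hJ.image hf.continuous).isBounded.subset_closedBall_lt 0 0
  -- The radii are enlarged by 1 because δ ≤ 1.
  obtain ⟨L₁, hL₁, hfL₁⟩ := exists_dist_le_mul hf (R + 1)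
  obtain ⟨L₂, hL₂, hgL₂⟩ := exists_dist_le_mul hg (R' + 1)
  have hmem : ∀ {ρ : ℝ} {x y : Plane}, x ∈ closedBall (0 : Plane) ρ → dist y x ≤ 1 →
      y ∈ closedBall (0 : Plane) (ρ + 1) := fun {ρ x y} hx hy => by
    rw [mem_closedBall] at *
    linarith [dist_triangle y x 0]
  set L := max L₁ L₂
  have hL : 1 ≤ L := hL₁.trans (le_max_left _ _)
  have hfL : ∀ x ∈ J, ∀ y, dist y x ≤ 1 → dist (f y) (f x) ≤ L * dist y x := by
    intro x hx y hy
    refine (hfL₁ y (hmem (hJR hx) hy) x (hmem (hJR hx) (by simp))).trans ?_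
    gcongr
    exact le_max_left _ _
  have hgL : ∀ x ∈ J, ∀ y ∈ closedBall (0 : Plane) (R' + 1),
      dist (g y) x ≤ L * dist y (f x) := by
    intro x hx y hy
    have h := hgL₂ y hy (f x) (hmem (hJR' (mem_image_of_mem f hx)) (by simp))
    rw [hgf] at h
    refine h.trans ?_
    gcongr
    exact le_max_right _ _
  have hinj : Function.Injective f := Function.LeftInverse.injective hgf
  have hreg := hν.map hf.continuous hinj hJ (by linarith) hfL hL (fun x hx y hy => by
    have h := hgL y hy (f x) (hmem (hJR' (mem_image_of_mem f hx)) (by simp))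
    rwa [hgf] at h)
  have hstrip' : ∀ ε : ℝ, 0 < ε → ∃ η : ℝ, 0 < η ∧
      ∀ (n : Plane) (t : ℝ), ‖n‖ = 1 → (ν.map f).real (strip n t η) ≤ ε := by
    intro ε hε
    obtain ⟨η, hη, h⟩ := hT.exists_preimage_strip_le hν.compl hJ hne hstrip hf hg hfg hgf ε hε
    refine ⟨η, hη, fun n t hn => ?_⟩
    rw [Measure.real, Measure.map_apply hf.continuous.measurable
      (isClosed_strip n t η).measurableSet]
    exact h n t hn
  obtain ⟨C₀, hC₀, h⟩ := hreg.exists_isUnconcentrated hα₀ hα₁ (K := L ^ 2 + 1) (by nlinarith)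
    hR'.le hJR' (hne.image f) hstrip'
  exact ⟨C₀, L ^ 2 + 1, hC₀, by nlinarith, fun δ hδ hδ₁ =>
    isEquivalentTo_image_of_net hC₀ hL hJ hf.continuous hfg hfL
      (fun x hx y hy => hgL x hx y (hmem (hJR' (mem_image_of_mem f hx)) hy))
      (h C₀ le_rfl) hδ hδ₁⟩

end

end SelfSimilarPlane

/-! ### Neighbourhoods of the set and of its diffeomorphic images -/

theorem mainTheorem3 (α : ℝ) (hα₀ : 0 < α) (hα₁ : α ≤ 1)
    (J : Set SelfSimilarPlane.Plane) (hJ : SelfSimilarPlane.IsSelfSimilarOSC J)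
    (hdim : dimH J = ENNReal.ofReal α)
    (hline : ∀ ℓ : Set SelfSimilarPlane.Plane, SelfSimilarPlane.IsLine ℓ → ¬ J ⊆ ℓ) :
    (α = 1 → ∃ κ C₀ K : ℝ, 0 < κ ∧ κ ≤ 1 / 2 ∧ 0 < C₀ ∧ 1 ≤ K ∧
      ∀ δ : ℝ, 0 < δ → δ ≤ 1 →
        SelfSimilarPlane.IsEquivalentTo (SelfSimilarPlane.IsUnrectifiableOneSet κ) K C₀ δ
          (SelfSimilarPlane.nbhd J δ)) ∧
    (α < 1 → ∃ C₀ K : ℝ, 0 < C₀ ∧ 1 ≤ K ∧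
      ∀ δ : ℝ, 0 < δ → δ ≤ 1 →
        SelfSimilarPlane.IsEquivalentTo (SelfSimilarPlane.IsUnconcentrated α) K C₀ δ
          (SelfSimilarPlane.nbhd J δ)) ∧
    (α < 1 →
      ∀ φ : Diffeomorph 𝓘(ℝ, SelfSimilarPlane.Plane) 𝓘(ℝ, SelfSimilarPlane.Plane)
        SelfSimilarPlane.Plane SelfSimilarPlane.Plane 1,
      ∃ C₀ K : ℝ, 0 < C₀ ∧ 1 ≤ K ∧
        ∀ δ : ℝ, 0 < δ → δ ≤ 1 →
          SelfSimilarPlane.IsEquivalentTo (SelfSimilarPlane.IsUnconcentrated α) K C₀ δ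
            (φ '' SelfSimilarPlane.nbhd J δ)) := by
  obtain ⟨s, T, O, ν, hO, hOne, hprob, hν, hT⟩ := hJ.exists_decomposition hα₀ hdim
  have hc := hJ.1
  have hne := hJ.2.1
  obtain ⟨c, C, hreg⟩ := hT.exists_isRegularMeasure hα₀.le hν hc.isBounded hO hOne
  obtain ⟨κ, B, hκ₀, hκ₁, hB, hpow⟩ := hT.exists_strip_bound hα₀.le hν hc.isBounded hne hline
  have hstrip := SelfSimilarPlane.exists_strip_le hκ₀ hB hpow
  obtain ⟨R, hR, hJR⟩ := hc.isBounded.subset_closedBall_lt 0 0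
  refine ⟨fun hα => ?_, fun _ => ?_, fun _ φ => ?_⟩
  · subst hα
    obtain ⟨B', hB', hslab⟩ := hT.exists_slab_bound hν hc.isBounded hO hOne hκ₀
      (by linarith) hB hpow
    obtain ⟨C₀, hC₀, h⟩ := hreg.exists_isUnrectifiableOneSet hB'.le hκ₀ hκ₁ hslab one_le_two
      hR.le hJR hne hstrip
    exact ⟨κ, C₀, 2, hκ₀, hκ₁, hC₀, one_le_two, fun δ hδ hδ₁ =>
      SelfSimilarPlane.isEquivalentTo_of_net hC₀ hc (h C₀ le_rfl) hδ hδ₁⟩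
  · obtain ⟨C₀, hC₀, h⟩ := hreg.exists_isUnconcentrated hα₀ hα₁ one_le_two hR.le hJR hne hstrip
    exact ⟨C₀, 2, hC₀, one_le_two, fun δ hδ hδ₁ =>
      SelfSimilarPlane.isEquivalentTo_of_net hC₀ hc (h C₀ le_rfl) hδ hδ₁⟩
  · exact hT.exists_isEquivalentTo_image hα₀ hα₁ hreg hc hne hstrip
      (contMDiff_iff_contDiff.1 φ.contMDiff) (contMDiff_iff_contDiff.1 φ.symm.contMDiff)
      φ.apply_symm_apply φ.symm_apply_apply
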